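/- Let $\ell^2$ be the real Hilbert space of square summable sequences with its standard orthonormal basis $e_1,e_2,\dots$, and identify $\mathbb R^d$ with the linear span of $e_1,\dots,e_d$. Let $d_H$ be the Hausdorff distance on nonempty compact subsets of $\ell^2$. Two such sets $K_1,K_2$ are called equivalent, $K_1\sim K_2$, if there is a distance-preserving bijection $K_1\to K_2$; let $[K]$ be the equivalence class of $K$ and $\mathbb H$ the set of all equivalence classes. The Hausdorff distance up to isometry is $$d_\sim([K_1],[K_2])=\inf\{d_H(K_1',K_2') : K_1'\in[K_1],\ K_2'\in[K_2]\}.$$ The Wiener spiral is the compact set $\mathbb W=\{\widetilde w_t: 0\le t\le 1\}\subset\ell^2$, where $$\widetilde w_t=\frac{2\sqrt2}{\pi}\sum_{k=1}^\infty\frac{\sin(\pi(k-1/2)t)}{2k-1}\,e_k .$$ For every $d\in\mathbb N=\{1,2,\dots\}$ let $X^{(d)}_1,X^{(d)}_2,\dots$ be independent copies of a random vector $X^{(d)}=(X^{(d)}_{\cdot,1},\dots,X^{(d)}_{\cdot,d})$ in $\mathbb R^d$ (for different $d$ the probability spaces may be different), and put $S^{(d)}_0=0$, $S^{(d)}_k=X^{(d)}_1+\dots+X^{(d)}_k$.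 Assume: (a) $\mathbb E X^{(d)}=0$ and $\mathbb E\|X^{(d)}\|^2=1$ for every $d\in\mathbb N$; (b) $\mathbb E[X^{(d)}_{\cdot,j}X^{(d)}_{\cdot,k}]=0$ for all $d\in\mathbb N$ and $j\ne k$ in $\{1,\dots,d\}$; (c) $\lim_{A\to\infty}\sup_{d\in\mathbb N}\mathbb E\big[\|X^{(d)}\|^2\mathbf 1_{\{\|X^{(d)}\|^2>A\}}\big]=0$; (d) $\lim_{d\to\infty}\max_{1\le k\le d}\mathbb E (X^{(d)}_{\cdot,k})^2=0$. Let $n=n(d)$ be an arbitrary sequence of positive integers with $n(d)\to\infty$ as $d\to\infty$, and let $\mathbb M_d=\{S^{(d)}_k/\sqrt n: 0\le k\le n\}\subset\mathbb R^d\subset\ell^2$. **Theorem.** $[\operatorname{conv}\mathbb M_d]$ converges in probability to $[\overline{\operatorname{conv}}\,\mathbb W]$ in $(\mathbb H,d_\sim)$ as $d\to\infty$; that is, for every $\varepsilon>0$, $$\lim_{d\to\infty}\mathbb P\big[d_\sim([\operatorname{conv}\mathbb M_d],[\overline{\operatorname{conv}}\,\mathbb W])>\varepsilon\big]=0 .$$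 Moreover, the closed convex hull map $\mathrm{CCH}:\mathbb H\to\mathbb H$, $\mathrm{CCH}([K])=[\overline{\operatorname{conv}}\,K]$, is well defined and 1-Lipschitz: $d_\sim(\mathrm{CCH}(x),\mathrm{CCH}(y))\le d_\sim(x,y)$ for all $x,y\in\mathbb H$. -/

import Mathlib

open MeasureTheory ProbabilityTheory Filter Topology TopologicalSpace

noncomputable section

namespace WienerSpiral

/-- The real Hilbert space of square summable sequences. The basis vector usually called `e_{k+1}`
is `lp.single 2 k 1`, for `k = 0, 1, 2, …`. -/
abbrev L2Seq : Type := lp (fun _ : ℕ => ℝ) 2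

/-- The inclusion of `ℝ^d` in the space of square summable sequences, as the span of the first `d`
basis vectors. -/
def embed (d : ℕ) (x : EuclideanSpace ℝ (Fin d)) : L2Seq :=
  ∑ i : Fin d, lp.single 2 (i : ℕ) (x i)

/-! ### Compact sets up to isometry -/

/-- Two nonempty compact sets are equivalent if there is a distance-preserving bijection between
them (not necessarily defined outside of these sets). -/
def isometrySetoid : Setoid (NonemptyCompacts L2Seq) where
  r K L := Nonempty (K ≃ᵢ L)
  iseqv :=
    { refl := fun K => ⟨IsometryEquiv.refl K⟩
      symm := fun ⟨e⟩ => ⟨e.symm⟩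
      trans := fun ⟨e⟩ ⟨f⟩ => ⟨e.trans f⟩ }

/-- The set `ℍ` of isometry classes of nonempty compact subsets of `ℓ²`. -/
def Shape : Type := Quotient isometrySetoid

/-- The isometry class `[K]`. -/
def Shape.mk (K : NonemptyCompacts L2Seq) : Shape := Quotient.mk isometrySetoid K

/-- The Hausdorff distance up to isometry: the infimum of the Hausdorff distances of
representatives. The metric `dist` on `NonemptyCompacts L2Seq` is the Hausdorff distance. -/
def Shape.hdist (x y : Shape) : ℝ :=
  ⨅ p : {p : NonemptyCompacts L2Seq × NonemptyCompacts L2Seq //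
    Shape.mk p.1 = x ∧ Shape.mk p.2 = y}, dist p.1.1 p.1.2

/-- The closed convex hull of a nonempty compact set. -/
def cch (K : NonemptyCompacts L2Seq) : NonemptyCompacts L2Seq where
  carrier := closure (convexHull ℝ (K : Set L2Seq))
  isCompact' :=
    (totallyBounded_convexHull.2 K.isCompact.totallyBounded).closure.isCompact_of_isClosed
      isClosed_closure
  nonempty' := K.nonempty.convexHull.closure

/-! ### The Wiener spiral -/

/-- The coordinates of the Wiener spiral in `ℓ²`; the index `k` here is `k - 1` in the usual
formula `(2 √2 / π) sin (π (k - 1/2) t) / (2 k - 1)` with `k ≥ 1`. -/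
def spiralCoord (t : ℝ) (k : ℕ) : ℝ :=
  2 * √2 / Real.pi * (Real.sin (Real.pi * (k + 1 / 2) * t) / (2 * k + 1))

theorem summable_bound : Summable fun k : ℕ => (2 * √2 / Real.pi / (2 * (k : ℝ) + 1)) ^ 2 := by
  have h := ((summable_nat_add_iff 1).2
    (Real.summable_one_div_nat_pow.2 (by norm_num : 1 < 2))).mul_left ((2 * √2 / Real.pi) ^ 2)
  refine Summable.of_nonneg_of_le (fun k => sq_nonneg _) (fun k => ?_) h
  rw [div_pow, div_eq_mul_one_div]
  have hk : (0 : ℝ) ≤ k := k.cast_nonneg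
  push_cast
  gcongr
  linarith

theorem abs_spiralCoord_le (t : ℝ) (k : ℕ) :
    |spiralCoord t k| ≤ 2 * √2 / Real.pi / (2 * (k : ℝ) + 1) := by
  have hk : (0 : ℝ) < 2 * k + 1 := by positivity
  have hc : (0 : ℝ) ≤ 2 * √2 / Real.pi := by positivity
  rw [spiralCoord, abs_mul, abs_of_nonneg hc, abs_div, abs_of_pos hk, ← mul_one_div (_ / Real.pi)]
  gcongr
  exact Real.abs_sin_le_one _

theorem memlp_spiralCoord (t : ℝ) : Memℓp (E := fun _ : ℕ => ℝ) (spiralCoord t) 2 := by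
  refine memℓp_gen ?_
  refine Summable.of_nonneg_of_le (fun k => by positivity) (fun k => ?_) summable_bound
  have h2 : (2 : ENNReal).toReal = ((2 : ℕ) : ℝ) := by simp
  rw [h2, Real.rpow_natCast, Real.norm_eq_abs]
  have := abs_spiralCoord_le t k
  gcongr

/-- The point of the Wiener spiral in `ℓ²` with parameter `t`. -/
def spiralPoint (t : ℝ) : L2Seq := ⟨spiralCoord t, memlp_spiralCoord t⟩

theorem continuous_spiralPoint : Continuous spiralPoint := by
  have h2 : (2 : ENNReal).toReal = ((2 : ℕ) : ℝ) := by simp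
  rw [continuous_iff_continuousAt]
  intro s
  rw [ContinuousAt, tendsto_iff_norm_sub_tendsto_zero]
  have hsq : ∀ t, ‖spiralPoint t - spiralPoint s‖ ^ 2 =
      ∑' k : ℕ, (spiralCoord t k - spiralCoord s k) ^ 2 := by
    intro t
    have h := lp.norm_rpow_eq_tsum (p := 2) (by simp) (spiralPoint t - spiralPoint s)
    simp only [h2, Real.rpow_natCast] at h
    rw [h]
    refine tsum_congr fun k => ?_
    rw [Real.norm_eq_abs, sq_abs]
    rfl
  have hcont : Continuous fun t => ∑' k : ℕ, (spiralCoord t k - spiralCoord s k) ^ 2 := by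
    refine continuous_tsum (fun k => ?_) (summable_bound.mul_left 4) (fun k t => ?_)
    · unfold spiralCoord
      fun_prop
    · rw [Real.norm_eq_abs, abs_pow]
      have h1 := abs_spiralCoord_le t k
      have h3 := abs_spiralCoord_le s k
      have h4 : |spiralCoord t k - spiralCoord s k| ≤
          2 * (2 * √2 / Real.pi / (2 * (k : ℝ) + 1)) :=
        (abs_sub _ _).trans (by linarith)
      calc |spiralCoord t k - spiralCoord s k| ^ 2
          ≤ (2 * (2 * √2 / Real.pi / (2 * (k : ℝ) + 1))) ^ 2 := by gcongr
        _ = _ := by ring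
  have h0 := (hcont.tendsto s).sqrt
  simp only [sub_self, ne_eq, OfNat.ofNat_ne_zero, not_false_eq_true, zero_pow, tsum_zero,
    Real.sqrt_zero] at h0
  refine h0.congr fun t => ?_
  rw [← hsq, Real.sqrt_sq (norm_nonneg _)]

/-- The Wiener spiral as a compact subset of `ℓ²`. -/
def spiral : NonemptyCompacts L2Seq where
  carrier := spiralPoint '' Set.Icc 0 1
  isCompact' := isCompact_Icc.image continuous_spiralPoint
  nonempty' := (Set.nonempty_Icc.2 zero_le_one).image _

/-! ### The rescaled random walk -/

/-- The points `0, S_1 / √n, …, S_n / √n` in `ℓ²`, where `S_k` is the sum of the first `k` of the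
increments `x 0, x 1, …` in `ℝ^d`. -/
def walkPoints {d : ℕ} (n : ℕ) (x : ℕ → EuclideanSpace ℝ (Fin d)) : Set L2Seq :=
  (fun k : ℕ => embed d ((√(n : ℝ))⁻¹ • ∑ i ∈ Finset.range k, x i)) '' Set.Iic n

/-- The convex hull of the rescaled walk (it is compact, being the hull of a finite set). -/
def walkHull {d : ℕ} (n : ℕ) (x : ℕ → EuclideanSpace ℝ (Fin d)) : NonemptyCompacts L2Seq where
  carrier := convexHull ℝ (walkPoints n x)
  isCompact' := Set.Finite.isCompact_convexHull (𝕜 := ℝ) ((Set.finite_Iic n).image _)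
  nonempty' := (Set.nonempty_Iic.image _).convexHull

end WienerSpiral

end

noncomputable section

namespace WienerSpiral

/-! ### Closed convex hulls and isometries -/

/-! The closed convex hull map is 1-Lipschitz on isometry classes, so it suffices that the walk
itself converges to the spiral.

The spiral satisfies `‖w_t - w_s‖² = |t - s|`, a Fourier identity. In high dimension the rescaled
walk nearly does too: `‖S_k - S_j‖²/n` is a diagonal part, close to `(k - j)/n` by a truncated law
of large numbers, plus a sum of cross terms whose second moment is at most twice the largest
component variance (`IsIncrements.crossSum_moments`), which tends to zero. So at `N + 1` fixed grid
times the walk is almost isometric to the spiral.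

Almost equal distances must then be turned into Hausdorff closeness after moving both sets by
isometries (`exists_isometries_dist_grid_le`). The normalized grid increments of the spiral are
orthonormal, those of the walk nearly so; sending the former to a slightly shrunk copy of the latter
is a contraction `T` of finite rank. A dilation of `T` gives isometries `Φ`, `Ψ` of `ℓ²` with `⟪Φ z,
Ψ h⟫ = ⟪z, T h⟫`, and expanding the square shows that `Φ` of each walk point is close to `Ψ` of the
matching spiral point.

Between grid times the spiral moves by at most `√(1/N)`, and Ottaviani's inequality controls the
walk. With `N` fixed by the target accuracy, only finitely many bad events remain. -/

theorem inner_sub_fst_eq_inner_sub_snd {G : Set (L2Seq × L2Seq)}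
    (hG : ∀ a ∈ G, ∀ b ∈ G, dist a.1 b.1 = dist a.2 b.2) {o : L2Seq × L2Seq} (ho : o ∈ G)
    {a b : L2Seq × L2Seq} (ha : a ∈ closure (convexHull ℝ G))
    (hb : b ∈ closure (convexHull ℝ G)) :
    inner ℝ (a.1 - o.1) (b.1 - o.1) = inner ℝ (a.2 - o.2) (b.2 - o.2) := by
  have hconv : ∀ c : L2Seq × L2Seq, Convex ℝ {a : L2Seq × L2Seq |
      inner ℝ (a.1 - o.1) (c.1 - o.1) = inner ℝ (a.2 - o.2) (c.2 - o.2)} := by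
    intro c x hx y hy s t _ _ hst
    simp only [Set.mem_ofPred_eq] at hx hy ⊢
    have h1 : ∀ p q r : L2Seq, s • p + t • q - r = s • (p - r) + t • (q - r) := by
      intro p q r
      rw [smul_sub, smul_sub, sub_add_sub_comm, ← add_smul, hst, one_smul]
    rw [Prod.fst_add, Prod.snd_add, Prod.smul_fst, Prod.smul_fst, Prod.smul_snd, Prod.smul_snd,
      h1, h1, inner_add_left, inner_add_left, inner_smul_left, inner_smul_left, inner_smul_left,
      inner_smul_left, hx, hy]
  have hclosed : ∀ c : L2Seq × L2Seq, IsClosed {a : L2Seq × L2Seq |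
      inner ℝ (a.1 - o.1) (c.1 - o.1) = inner ℝ (a.2 - o.2) (c.2 - o.2)} := by
    intro c
    exact isClosed_eq (by fun_prop) (by fun_prop)
  -- The identity is affine and closed in each variable separately, so it passes from `G` to the
  -- closed hull one variable at a time.
  have key : ∀ c : L2Seq × L2Seq,
      (∀ a ∈ G, inner ℝ (a.1 - o.1) (c.1 - o.1) = inner ℝ (a.2 - o.2) (c.2 - o.2)) →
      ∀ a ∈ closure (convexHull ℝ G),
        inner ℝ (a.1 - o.1) (c.1 - o.1) = inner ℝ (a.2 - o.2) (c.2 - o.2) := by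
    intro c hc
    exact closure_minimal (convexHull_min hc (hconv c)) (hclosed c)
  -- Polarization: inner products based at `o` are determined by the three mutual distances.
  have hbase : ∀ a ∈ G, ∀ c ∈ G,
      inner ℝ (a.1 - o.1) (c.1 - o.1) = inner ℝ (a.2 - o.2) (c.2 - o.2) := by
    intro a ha c hc
    have h1 := hG a ha c hc
    have h2 := hG a ha o ho
    have h3 := hG c hc o ho
    simp only [dist_eq_norm] at h1 h2 h3
    rw [← sub_sub_sub_cancel_right a.1 _ o.1, ← sub_sub_sub_cancel_right a.2 _ o.2] at h1
    rw [real_inner_eq_norm_mul_self_add_norm_mul_self_sub_norm_sub_mul_self_div_two,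
      real_inner_eq_norm_mul_self_add_norm_mul_self_sub_norm_sub_mul_self_div_two, h1, h2, h3]
  refine key b (fun a ha => ?_) a ha
  rw [real_inner_comm, real_inner_comm (b.2 - o.2)]
  exact key a (fun c hc => hbase c hc a ha) b hb

theorem dist_fst_eq_dist_snd {G : Set (L2Seq × L2Seq)}
    (hG : ∀ a ∈ G, ∀ b ∈ G, dist a.1 b.1 = dist a.2 b.2) {o : L2Seq × L2Seq} (ho : o ∈ G)
    {a b : L2Seq × L2Seq} (ha : a ∈ closure (convexHull ℝ G))
    (hb : b ∈ closure (convexHull ℝ G)) : dist a.1 b.1 = dist a.2 b.2 := by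
  have haa := inner_sub_fst_eq_inner_sub_snd hG ho ha ha
  have hab := inner_sub_fst_eq_inner_sub_snd hG ho ha hb
  have hbb := inner_sub_fst_eq_inner_sub_snd hG ho hb hb
  rw [real_inner_self_eq_norm_sq, real_inner_self_eq_norm_sq] at haa hbb
  rw [dist_eq_norm, dist_eq_norm, ← sub_sub_sub_cancel_right a.1 _ o.1,
    ← sub_sub_sub_cancel_right a.2 b.2 o.2]
  refine (sq_eq_sq₀ (norm_nonneg _) (norm_nonneg _)).1 ?_
  rw [norm_sub_sq_real (a.1 - o.1), norm_sub_sq_real (a.2 - o.2), haa, hab, hbb]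

/-- The isometry `e` is not assumed to extend beyond `K`. Instead the closed convex hull `R` of its
graph is again the graph of an isometry: distances in the two coordinates agree on `R`, and `R`
projects onto both closed hulls because it is compact. -/
theorem nonempty_isometryEquiv_cch {K L : NonemptyCompacts L2Seq} (e : K ≃ᵢ L) :
    Nonempty (cch K ≃ᵢ cch L) := by
  set G : Set (L2Seq × L2Seq) := Set.range fun x : K => ((x : L2Seq), (e x : L2Seq)) with hGdef
  have hG : ∀ a ∈ G, ∀ b ∈ G, dist a.1 b.1 = dist a.2 b.2 := by
    rintro _ ⟨x, rfl⟩ _ ⟨y, rfl⟩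
    exact (e.isometry.dist_eq x y).symm
  have hGc : IsCompact G := by
    have : CompactSpace K := isCompact_iff_compactSpace.1 K.isCompact
    refine isCompact_range ?_
    have := e.continuous
    fun_prop
  obtain ⟨x₀, hx₀⟩ := K.nonempty
  have ho : ((x₀, (e ⟨x₀, hx₀⟩ : L2Seq)) : L2Seq × L2Seq) ∈ G := ⟨⟨x₀, hx₀⟩, rfl⟩
  set R := closure (convexHull ℝ G)
  have hR : IsCompact R :=
    (totallyBounded_convexHull.2 hGc.totallyBounded).closure.isCompact_of_isClosed
      isClosed_closure
  have hdist : ∀ a ∈ R, ∀ b ∈ R, dist a.1 b.1 = dist a.2 b.2 :=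
    fun a ha b hb => dist_fst_eq_dist_snd hG ho ha hb
  have hfst : Prod.fst '' R = (cch K : Set L2Seq) := by
    rw [image_closure_of_isCompact hR continuous_fst.continuousOn]
    have h1 : Prod.fst '' (convexHull ℝ G) = convexHull ℝ (Prod.fst '' G) :=
      LinearMap.image_convexHull (LinearMap.fst ℝ L2Seq L2Seq) G
    have h2 : Prod.fst '' G = (K : Set L2Seq) := by
      rw [hGdef, ← Set.range_comp]
      exact Subtype.range_coe
    rw [h1, h2]
    rfl
  have hsnd : Prod.snd '' R = (cch L : Set L2Seq) := by
    rw [image_closure_of_isCompact hR continuous_snd.continuousOn]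
    have h1 : Prod.snd '' (convexHull ℝ G) = convexHull ℝ (Prod.snd '' G) :=
      LinearMap.image_convexHull (LinearMap.snd ℝ L2Seq L2Seq) G
    have h2 : Prod.snd '' G = (L : Set L2Seq) := by
      rw [hGdef, ← Set.range_comp]
      change Set.range ((fun y : L => (y : L2Seq)) ∘ e) = _
      rw [e.surjective.range_comp]
      exact Subtype.range_coe
    rw [h1, h2]
    rfl
  have hf : ∀ x : cch K, ∃ y : cch L, ((x : L2Seq), (y : L2Seq)) ∈ R := by
    rintro ⟨x, hx⟩
    change x ∈ (cch K : Set L2Seq) at hx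
    rw [← hfst] at hx
    obtain ⟨⟨a, b⟩, hab, rfl⟩ := hx
    exact ⟨⟨b, by
      change b ∈ (cch L : Set L2Seq)
      rw [← hsnd]
      exact ⟨_, hab, rfl⟩⟩, hab⟩
  choose f hf using hf
  have hfi : Isometry f := Isometry.of_dist_eq fun x y => (hdist _ (hf x) _ (hf y)).symm
  refine ⟨IsometryEquiv.mk (Equiv.ofBijective f ⟨hfi.injective, ?_⟩) hfi⟩
  rintro ⟨y, hy⟩
  change y ∈ (cch L : Set L2Seq) at hy
  rw [← hsnd] at hy
  obtain ⟨⟨a, b⟩, hab, rfl⟩ := hy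
  have ha : a ∈ (cch K : Set L2Seq) := by
    rw [← hfst]
    exact ⟨_, hab, rfl⟩
  refine ⟨⟨a, ha⟩, Subtype.ext ?_⟩
  -- Two points of `R` with the same first coordinate have second coordinates at distance zero.
  have := hdist _ (hf ⟨a, ha⟩) _ hab
  simp only [dist_self] at this
  exact dist_eq_zero.1 this.symm

/-! ### Hausdorff distance and the Lipschitz property of the closed convex hull. -/

theorem dist_le_of_forall_exists_dist_le {K L : NonemptyCompacts L2Seq} {r : ℝ} (hr : 0 ≤ r)
    (h₁ : ∀ x ∈ K, ∃ y ∈ L, dist x y ≤ r) (h₂ : ∀ y ∈ L, ∃ x ∈ K, dist y x ≤ r) :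
    dist K L ≤ r := by
  rw [Metric.NonemptyCompacts.dist_eq]
  exact Metric.hausdorffDist_le_of_mem_dist hr h₁ h₂

theorem exists_dist_le_dist {K L : NonemptyCompacts L2Seq} {x : L2Seq} (hx : x ∈ K) :
    ∃ y ∈ L, dist x y ≤ dist K L := by
  obtain ⟨y, hy, hxy⟩ := L.isCompact.exists_infDist_eq_dist L.nonempty x
  refine ⟨y, hy, ?_⟩
  rw [← hxy, Metric.NonemptyCompacts.dist_eq]
  exact Metric.infDist_le_hausdorffDist_of_mem hx
    (Metric.hausdorffEDist_ne_top_of_nonempty_of_bounded K.nonempty L.nonempty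
      K.isCompact.isBounded L.isCompact.isBounded)

/-- A closed thickening of a convex set is closed and convex, so once it contains `K` it contains
`cch K`; compactness of `cch L` provides a point attaining the bound. -/
theorem exists_mem_cch_dist_le {K L : NonemptyCompacts L2Seq} {x : L2Seq} (hx : x ∈ cch K) :
    ∃ y ∈ cch L, dist x y ≤ dist K L := by
  have hsub : (cch K : Set L2Seq) ⊆ Metric.cthickening (dist K L) (cch L : Set L2Seq) := by
    refine closure_minimal (convexHull_min (fun z hz => ?_) ?_) Metric.isClosed_cthickening
    · obtain ⟨y, hy, hzy⟩ := exists_dist_le_dist (L := L) hz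
      exact Metric.mem_cthickening_of_dist_le z y _ _
        (subset_closure (subset_convexHull ℝ _ hy)) hzy
    · exact (convex_convexHull ℝ (L : Set L2Seq)).closure.cthickening _
  have := hsub hx
  rw [(cch L).isCompact.cthickening_eq_biUnion_closedBall dist_nonneg] at this
  simpa using this

theorem dist_cch_le (K L : NonemptyCompacts L2Seq) : dist (cch K) (cch L) ≤ dist K L := by
  refine dist_le_of_forall_exists_dist_le dist_nonneg (fun x hx => exists_mem_cch_dist_le hx)
    fun y hy => ?_
  rw [dist_comm K L]
  exact exists_mem_cch_dist_le hy

theorem Shape.hdist_le {x y : Shape} {K L : NonemptyCompacts L2Seq} (hK : Shape.mk K = x)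
    (hL : Shape.mk L = y) : Shape.hdist x y ≤ dist K L :=
  ciInf_le (f := fun p : {p : NonemptyCompacts L2Seq × NonemptyCompacts L2Seq //
    Shape.mk p.1 = x ∧ Shape.mk p.2 = y} => dist p.1.1 p.1.2)
    ⟨0, by rintro _ ⟨p, rfl⟩; exact dist_nonneg⟩ ⟨(K, L), hK, hL⟩

/-- The closed convex hull map on isometry classes. -/
def Shape.cch : Shape → Shape :=
  Quotient.lift (fun K => Shape.mk (WienerSpiral.cch K)) fun _ _ ⟨e⟩ =>
    Quotient.sound (nonempty_isometryEquiv_cch e)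

theorem Shape.cch_mk (K : NonemptyCompacts L2Seq) :
    Shape.cch (Shape.mk K) = Shape.mk (WienerSpiral.cch K) := rfl

theorem Shape.hdist_cch_le (x y : Shape) :
    Shape.hdist (Shape.cch x) (Shape.cch y) ≤ Shape.hdist x y := by
  have : Nonempty {p : NonemptyCompacts L2Seq × NonemptyCompacts L2Seq //
      Shape.mk p.1 = x ∧ Shape.mk p.2 = y} := by
    obtain ⟨K, hK⟩ := Quotient.exists_rep x
    obtain ⟨L, hL⟩ := Quotient.exists_rep y
    exact ⟨⟨(K, L), hK, hL⟩⟩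
  refine le_ciInf ?_
  rintro ⟨⟨K, L⟩, hK, hL⟩
  refine (Shape.hdist_le (K := WienerSpiral.cch K) (L := WienerSpiral.cch L) ?_ ?_).trans
    (dist_cch_le K L)
  · rw [← hK, Shape.cch_mk]
  · rw [← hL, Shape.cch_mk]

/-- The points of the rescaled walk as a compact set. -/
def walkSet {d : ℕ} (n : ℕ) (x : ℕ → EuclideanSpace ℝ (Fin d)) : NonemptyCompacts L2Seq where
  carrier := walkPoints n x
  isCompact' := ((Set.finite_Iic n).image _).isCompact
  nonempty' := Set.nonempty_Iic.image _

theorem cch_walkSet {d : ℕ} (n : ℕ) (x : ℕ → EuclideanSpace ℝ (Fin d)) :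
    cch (walkSet n x) = walkHull n x :=
  NonemptyCompacts.ext (walkHull n x).isCompact.isClosed.closure_eq

/-- The image of a compact set under an isometry represents the same shape. -/
theorem Shape.mk_map (K : NonemptyCompacts L2Seq) (f : L2Seq → L2Seq) (hf : Isometry f) :
    Shape.mk (K.map f hf.continuous) = Shape.mk K := by
  refine (Quotient.sound ⟨?_⟩ : Shape.mk K = Shape.mk (K.map f hf.continuous)).symm
  refine IsometryEquiv.mk (Equiv.Set.image f (K : Set L2Seq) hf.injective) ?_
  exact Isometry.of_dist_eq fun x y => hf.dist_eq _ _

/-! ### The metric of the Wiener spiral -/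

/-- This is the Fourier series of the Bernoulli polynomial `B₂`. -/
theorem hasSum_cos_div_sq {x : ℝ} (hx : x ∈ Set.Icc (0 : ℝ) 1) :
    HasSum (fun n : ℕ => 1 / (n : ℝ) ^ 2 * Real.cos (2 * Real.pi * n * x))
      (Real.pi ^ 2 * (x ^ 2 - x + 1 / 6)) := by
  convert! hasSum_one_div_nat_pow_mul_cos one_ne_zero hx using 1
  have h : Polynomial.bernoulli 2 =
      Polynomial.X ^ 2 - Polynomial.X + Polynomial.C (1 / 6 : ℚ) := by
    simp only [Polynomial.bernoulli, Finset.sum_range_succ, Finset.range_one,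
      Finset.sum_singleton, ← Polynomial.C_mul_X_pow_eq_monomial]
    rw [bernoulli_zero, bernoulli_one, bernoulli_eq_bernoulli'_of_ne_one (by decide : 2 ≠ 1),
      bernoulli'_two]
    norm_num [Nat.choose]
    ring
  rw [mul_one, h]
  simp only [Nat.factorial, Polynomial.map_add, Polynomial.map_sub, Polynomial.map_pow,
    Polynomial.map_X, Polynomial.map_C, Polynomial.eval_add, Polynomial.eval_sub,
    Polynomial.eval_pow, Polynomial.eval_X, Polynomial.eval_C]
  rw [eq_ratCast]
  push_cast
  ring

/-- Subtract the even terms, which form a quarter of the full series at `2 * x`; this forces `x ≤ 1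
/ 2`. The quadratic parts cancel. -/
theorem hasSum_cos_odd_div_sq {x : ℝ} (hx : x ∈ Set.Icc (0 : ℝ) (1 / 2)) :
    HasSum (fun n : ℕ => 1 / (2 * (n : ℝ) + 1) ^ 2 * Real.cos (2 * Real.pi * (2 * n + 1) * x))
      (Real.pi ^ 2 / 8 - Real.pi ^ 2 * x / 2) := by
  obtain ⟨h0, h1⟩ := hx
  have hall := hasSum_cos_div_sq (x := x) ⟨h0, by linarith⟩
  have heven := (hasSum_cos_div_sq (x := 2 * x) ⟨by linarith, by linarith⟩).div_const 4
  set f : ℕ → ℝ := fun n => 1 / (n : ℝ) ^ 2 * Real.cos (2 * Real.pi * n * x) with hf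
  have he : HasSum (fun k => f (2 * k)) (Real.pi ^ 2 * ((2 * x) ^ 2 - 2 * x + 1 / 6) / 4) := by
    convert! heven using 1
    funext k
    simp only [hf]
    push_cast
    rw [show 2 * Real.pi * (2 * (k : ℝ)) * x = 2 * Real.pi * k * (2 * x) by ring]
    rcases eq_or_ne (k : ℝ) 0 with hk | hk
    · simp [hk]
    · field_simp
      ring_nf
  have ho : Summable fun k => f (2 * k + 1) :=
    hall.summable.comp_injective fun a b (h : 2 * a + 1 = 2 * b + 1) => by omega
  have hsum := (he.even_add_odd ho.hasSum).unique hall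
  have hval : ∑' k, f (2 * k + 1) = Real.pi ^ 2 / 8 - Real.pi ^ 2 * x / 2 := by
    linear_combination hsum
  have := ho.hasSum
  rw [hval] at this
  convert! this using 1
  funext k
  simp [hf]

theorem hasSum_sq_spiralCoord_sub {s t : ℝ} (hs : 0 ≤ s) (hst : s ≤ t) (ht : t ≤ 1) :
    HasSum (fun k => (spiralCoord t k - spiralCoord s k) ^ 2) (t - s) := by
  -- These five series come from `(sin a - sin b)² = 1 - cos(2a)/2 - cos(2b)/2 - cos(a - b) + cos(a
  -- + b)`.
  have h1 := hasSum_cos_odd_div_sq (x := 0) ⟨le_rfl, by norm_num⟩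
  have h2 := hasSum_cos_odd_div_sq (x := t / 2) ⟨by linarith, by linarith⟩
  have h3 := hasSum_cos_odd_div_sq (x := s / 2) ⟨by linarith, by linarith⟩
  have h4 := hasSum_cos_odd_div_sq (x := (t - s) / 4) ⟨by linarith, by linarith⟩
  have h5 := hasSum_cos_odd_div_sq (x := (t + s) / 4) ⟨by linarith, by linarith⟩
  have h := ((((h1.sub (h2.div_const 2)).sub (h3.div_const 2)).sub h4).add h5).mul_left
    (8 / Real.pi ^ 2)
  have hpi : Real.pi ≠ 0 := Real.pi_ne_zero
  convert! h using 1
  · funext k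
    have hk : (2 * (k : ℝ) + 1) ≠ 0 := by positivity
    simp only [spiralCoord]
    set a := Real.pi * (k + 1 / 2) * t with ha
    set b := Real.pi * (k + 1 / 2) * s with hb
    rw [show 2 * Real.pi * (2 * (k : ℝ) + 1) * (t / 2) = 2 * a by rw [ha]; ring,
      show 2 * Real.pi * (2 * (k : ℝ) + 1) * (s / 2) = 2 * b by rw [hb]; ring,
      show 2 * Real.pi * (2 * (k : ℝ) + 1) * ((t - s) / 4) = a - b by rw [ha, hb]; ring,
      show 2 * Real.pi * (2 * (k : ℝ) + 1) * ((t + s) / 4) = a + b by rw [ha, hb]; ring,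
      mul_zero, Real.cos_zero, Real.cos_two_mul', Real.cos_two_mul', Real.cos_sub, Real.cos_add]
    have hsq : √2 ^ 2 = 2 := Real.sq_sqrt (by norm_num)
    have hca := Real.sin_sq_add_cos_sq a
    have hcb := Real.sin_sq_add_cos_sq b
    have : (2 * √2 / Real.pi * (Real.sin a / (2 * k + 1)) -
        2 * √2 / Real.pi * (Real.sin b / (2 * k + 1))) ^ 2 =
        √2 ^ 2 * 4 / Real.pi ^ 2 / (2 * k + 1) ^ 2 * (Real.sin a - Real.sin b) ^ 2 := by
      field_simp
      ring
    rw [this, hsq]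
    field_simp
    linear_combination 8 * hca + 8 * hcb
  · field_simp
    ring

theorem norm_spiralPoint_sub_sq {s t : ℝ} (hs : s ∈ Set.Icc (0 : ℝ) 1)
    (ht : t ∈ Set.Icc (0 : ℝ) 1) : ‖spiralPoint t - spiralPoint s‖ ^ 2 = |t - s| := by
  wlog hst : s ≤ t generalizing s t
  · rw [norm_sub_rev, this ht hs (le_of_not_ge hst), abs_sub_comm]
  have h2 : (2 : ENNReal).toReal = ((2 : ℕ) : ℝ) := by simp
  have h := lp.norm_rpow_eq_tsum (p := 2) (by simp) (spiralPoint t - spiralPoint s)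
  simp only [h2, Real.rpow_natCast] at h
  rw [h, abs_of_nonneg (sub_nonneg.2 hst), ← (hasSum_sq_spiralCoord_sub hs.1 hst ht.2).tsum_eq]
  refine tsum_congr fun k => ?_
  rw [Real.norm_eq_abs, sq_abs]
  rfl

theorem spiralPoint_zero : spiralPoint 0 = 0 := by
  ext k
  simp [spiralPoint, spiralCoord]

/-- Inner products of increments depend only on four distances, so the metric controls Gram
matrices: exactly for the spiral, approximately for the walk. -/
theorem four_point_inner {E : Type*} [NormedAddCommGroup E] [InnerProductSpace ℝ E]
    (a b c d : E) : 2 * inner ℝ (b - a) (d - c) =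
      ‖b - c‖ ^ 2 + ‖a - d‖ ^ 2 - ‖b - d‖ ^ 2 - ‖a - c‖ ^ 2 := by
  simp only [norm_sub_sq_real, inner_sub_left, inner_sub_right]
  ring

/-! ### Dilation of a contraction of finite rank -/

theorem orthonormal_single : Orthonormal ℝ fun k : ℕ => (lp.single 2 k (1 : ℝ) : L2Seq) := by
  have h := (HilbertBasis.ofRepr (LinearIsometryEquiv.refl ℝ L2Seq)).orthonormal
  convert! h using 1
  funext k
  rw [← HilbertBasis.repr_symm_single]
  rfl

/-- Splitting the basis indices modulo 3 gives three orthogonal copies of `ℓ²` inside itself, the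
room needed for the dilation. -/
theorem exists_orthogonal_isometries : ∃ σ : Fin 3 → L2Seq →ₗᵢ[ℝ] L2Seq,
    ∀ i j, i ≠ j → ∀ x y, inner ℝ (σ i x) (σ j y) = 0 := by
  have hv : ∀ i : Fin 3, Orthonormal ℝ fun k : ℕ =>
      (lp.single 2 (3 * k + i) (1 : ℝ) : L2Seq) := fun i =>
    orthonormal_single.comp (fun k : ℕ => 3 * k + (i : ℕ)) fun a b h => by
      simp only at h
      omega
  refine ⟨fun i => (hv i).orthogonalFamily.linearIsometry, fun i j hij x y => ?_⟩
  have hij' : (i : ℕ) ≠ j := fun h => hij (Fin.ext h)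
  have hi := (hv i).orthogonalFamily.hasSum_linearIsometry x
  have hj := (hv j).orthogonalFamily.hasSum_linearIsometry y
  have hzero : ∀ z : L2Seq, (∀ k, inner ℝ z (lp.single 2 (3 * k + j) (1 : ℝ) : L2Seq) = 0) →
      inner ℝ z ((hv j).orthogonalFamily.linearIsometry y) = 0 := by
    intro z hz
    refine (hj.mapL (innerSL ℝ z)).unique ?_
    convert! hasSum_zero using 1
    funext k
    simp [hz]
  refine hzero _ fun k => ?_
  rw [real_inner_comm]
  refine (hi.mapL (innerSL ℝ (lp.single 2 (3 * k + j) (1 : ℝ) : L2Seq))).unique ?_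
  convert! hasSum_zero using 1
  funext l
  have := orthonormal_single.2 (i := 3 * k + j) (j := 3 * l + i) (by omega)
  simp only at this
  simp [this]

/-- The finite rank operator `h ↦ ∑ i, ⟪a i, h⟫ b i`. -/
def finiteRank {m : ℕ} (a b : Fin m → L2Seq) : L2Seq →ₗ[ℝ] L2Seq :=
  ∑ i, (innerₛₗ ℝ (a i)).smulRight (b i)

theorem finiteRank_apply {m : ℕ} (a b : Fin m → L2Seq) (h : L2Seq) :
    finiteRank a b h = ∑ i, inner ℝ (a i) h • b i := by
  simp [finiteRank]

theorem norm_finiteRank_sq {m : ℕ} (a : Fin m → L2Seq) {b : Fin m → L2Seq}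
    (hb : Orthonormal ℝ b) (h : L2Seq) :
    ‖finiteRank a b h‖ ^ 2 = ∑ i, inner ℝ (a i) h ^ 2 := by
  rw [finiteRank_apply, ← real_inner_self_eq_norm_sq, hb.inner_sum]
  simp [sq]

/-- The identity minus the Gram matrix of `g` is positive semidefinite, hence a sum of rank one
squares. The vectors `v` play the role of the defect operator of a contraction. -/
theorem exists_sum_sq_eq_sub {m : ℕ} (g : Fin m → L2Seq)
    (hg : ∀ ξ : Fin m → ℝ, ‖∑ i, ξ i • g i‖ ^ 2 ≤ ∑ i, ξ i ^ 2) :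
    ∃ (r : ℕ) (v : Fin r → Fin m → ℝ), ∀ ξ : Fin m → ℝ,
      ∑ l, (∑ i, v l i * ξ i) ^ 2 = ∑ i, ξ i ^ 2 - ‖∑ i, ξ i • g i‖ ^ 2 := by
  set M : Matrix (Fin m) (Fin m) ℝ := 1 - Matrix.of fun i j => inner ℝ (g i) (g j) with hM
  have hform : ∀ ξ : Fin m → ℝ,
      ξ ⬝ᵥ (M.mulVec ξ) = ∑ i, ξ i ^ 2 - ‖∑ i, ξ i • g i‖ ^ 2 := by
    intro ξ
    rw [hM, Matrix.sub_mulVec, dotProduct_sub, Matrix.one_mulVec, ← real_inner_self_eq_norm_sq,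
      sum_inner]
    congr 1
    · simp [dotProduct, sq]
    · simp only [dotProduct, Matrix.mulVec, Matrix.of_apply, inner_sum, inner_smul_left,
        inner_smul_right, Finset.mul_sum]
      refine Finset.sum_congr rfl fun i _ => Finset.sum_congr rfl fun j _ => ?_
      simp
      ring
  have hpsd : M.PosSemidef := by
    refine Matrix.PosSemidef.of_dotProduct_mulVec_nonneg ?_ fun ξ => ?_
    · refine Matrix.isHermitian_one.sub (Matrix.IsHermitian.ext fun i j => ?_)
      simp [real_inner_comm]
    · rw [star_trivial, hform]
      linarith [hg ξ]
  obtain ⟨r, v, hv⟩ := Matrix.posSemidef_iff_eq_sum_vecMulVec.1 hpsd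
  refine ⟨r, v, fun ξ => ?_⟩
  rw [← hform, hv, Matrix.sum_mulVec, dotProduct_sum]
  refine Finset.sum_congr rfl fun l _ => ?_
  rw [Matrix.vecMulVec_mulVec, star_trivial]
  simp [dotProduct, sq, Finset.mul_sum, mul_comm, mul_left_comm]

/-- Write `T = finiteRank f g` and let `p` be the orthogonal projection onto the span of `f`. Take
`Φ = σ 0` and `Ψ h = σ 0 (T h) + σ 1 (h - p h) + σ 2 (D h)` with `‖D h‖² = ‖p h‖² - ‖T h‖²`; by
Pythagoras `Ψ` is isometric, and only the first summand meets the range of `Φ`. -/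
theorem exists_isometries_inner_eq {m : ℕ} {f g : Fin m → L2Seq} (hf : Orthonormal ℝ f)
    (hg : ∀ ξ : Fin m → ℝ, ‖∑ i, ξ i • g i‖ ^ 2 ≤ ∑ i, ξ i ^ 2) :
    ∃ Φ Ψ : L2Seq →ₗᵢ[ℝ] L2Seq, ∀ z h, inner ℝ (Φ z) (Ψ h) = inner ℝ z (finiteRank f g h) := by
  obtain ⟨σ, hσ⟩ := exists_orthogonal_isometries
  obtain ⟨r, v, hv⟩ := exists_sum_sq_eq_sub g hg
  have he : Orthonormal ℝ fun l : Fin r => (lp.single 2 (l : ℕ) (1 : ℝ) : L2Seq) :=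
    orthonormal_single.comp _ Fin.val_injective
  set D : L2Seq →ₗ[ℝ] L2Seq :=
    finiteRank (fun l => ∑ i, v l i • f i) fun l : Fin r => (lp.single 2 (l : ℕ) (1 : ℝ) : L2Seq)
  set Q : L2Seq →ₗ[ℝ] L2Seq := LinearMap.id - finiteRank f f
  set L : L2Seq →ₗ[ℝ] L2Seq := (σ 0).toLinearMap ∘ₗ finiteRank f g +
    (σ 1).toLinearMap ∘ₗ Q + (σ 2).toLinearMap ∘ₗ D
  have hL : ∀ h, L h = σ 0 (finiteRank f g h) + σ 1 (Q h) + σ 2 (D h) := fun h => rfl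
  have hD : ∀ h, ‖D h‖ ^ 2 = ∑ i, inner ℝ (f i) h ^ 2 - ‖finiteRank f g h‖ ^ 2 := by
    intro h
    rw [norm_finiteRank_sq _ he, finiteRank_apply, ← hv]
    simp [sum_inner, inner_smul_left]
  have hQ : ∀ h, ‖Q h‖ ^ 2 = ‖h‖ ^ 2 - ∑ i, inner ℝ (f i) h ^ 2 := by
    intro h
    change ‖h - finiteRank f f h‖ ^ 2 = _
    rw [norm_sub_sq_real, norm_finiteRank_sq f hf, finiteRank_apply, inner_sum]
    simp only [inner_smul_right]
    simp only [real_inner_comm, ← sq]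
    ring
  have hnorm : ∀ h, ‖L h‖ = ‖h‖ := by
    intro h
    refine (sq_eq_sq₀ (norm_nonneg _) (norm_nonneg _)).1 ?_
    rw [hL, norm_add_sq_real, norm_add_sq_real, inner_add_left, hσ 0 1 (by decide),
      hσ 0 2 (by decide), hσ 1 2 (by decide), (σ 0).norm_map, (σ 1).norm_map, (σ 2).norm_map,
      hD, hQ]
    ring
  refine ⟨σ 0, ⟨L, hnorm⟩, fun z h => ?_⟩
  change inner ℝ (σ 0 z) (L h) = _
  rw [hL, inner_add_right, inner_add_right, hσ 0 1 (by decide), hσ 0 2 (by decide),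
    (σ 0).inner_map_map, add_zero, add_zero]

/-! ### Almost isometric copies of a grid on the spiral -/

theorem div_mem_Icc {N i : ℕ} (hN : 0 < N) (hi : i ≤ N) : (i / N : ℝ) ∈ Set.Icc (0 : ℝ) 1 := by
  have : (0 : ℝ) < N := by exact_mod_cast hN
  exact ⟨by positivity, (div_le_one this).2 (by exact_mod_cast hi)⟩

theorem norm_spiralPoint_div_sub_sq {N i j : ℕ} (hN : 0 < N) (hi : i ≤ N) (hj : j ≤ N) :
    ‖spiralPoint (i / N) - spiralPoint (j / N)‖ ^ 2 = |(i : ℝ) - j| / N := by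
  have : (0 : ℝ) < N := by exact_mod_cast hN
  rw [norm_spiralPoint_sub_sq (div_mem_Icc hN hj) (div_mem_Icc hN hi), ← sub_div, abs_div,
    abs_of_pos this]

/-- Combined with `four_point_inner`, this says that squared distances `|i - j|` make increments
over distinct unit steps orthogonal. -/
theorem four_point_abs {i j : ℕ} :
    |((i + 1 : ℕ) : ℝ) - j| + |(i : ℝ) - (j + 1 : ℕ)| - |((i + 1 : ℕ) : ℝ) - (j + 1 : ℕ)| -
      |(i : ℝ) - j| = if i = j then 2 else 0 := by
  push_cast
  rcases lt_trichotomy i j with h | h | h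
  · have h' : (i : ℝ) + 1 ≤ j := by exact_mod_cast h
    rw [if_neg h.ne, abs_of_nonpos (by linarith), abs_of_nonpos (by linarith),
      abs_of_nonpos (by linarith), abs_of_nonpos (by linarith)]
    ring
  · subst h
    norm_num
  · have h' : (j : ℝ) + 1 ≤ i := by exact_mod_cast h
    rw [if_neg h.ne', abs_of_nonneg (by linarith), abs_of_nonneg (by linarith),
      abs_of_nonneg (by linarith), abs_of_nonneg (by linarith)]
    ring

/-- The normalized increments of the spiral on a grid. -/
def spiralIncr (N : ℕ) (i : Fin N) : L2Seq :=
  √N • (spiralPoint ((i + 1 : ℕ) / N) - spiralPoint (i / N))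

theorem orthonormal_spiralIncr (N : ℕ) : Orthonormal ℝ (spiralIncr N) := by
  rcases Nat.eq_zero_or_pos N with rfl | hN
  · exact ⟨fun i => i.elim0, fun i => i.elim0⟩
  have hN' : (0 : ℝ) < N := by exact_mod_cast hN
  rw [orthonormal_iff_ite]
  intro i j
  have h := four_point_inner (spiralPoint (i / N)) (spiralPoint ((i + 1 : ℕ) / N))
    (spiralPoint (j / N)) (spiralPoint ((j + 1 : ℕ) / N))
  rw [norm_spiralPoint_div_sub_sq hN i.2 j.2.le, norm_spiralPoint_div_sub_sq hN i.2.le j.2,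
    norm_spiralPoint_div_sub_sq hN i.2 j.2, norm_spiralPoint_div_sub_sq hN i.2.le j.2.le,
    ← add_div, ← sub_div, ← sub_div, four_point_abs] at h
  rw [spiralIncr, spiralIncr, inner_smul_left, inner_smul_right]
  simp only [conj_trivial, ← mul_assoc, Real.mul_self_sqrt hN'.le]
  rw [← mul_right_inj' (two_ne_zero' ℝ), mul_left_comm, h]
  simp only [Fin.ext_iff]
  split_ifs
  · field_simp
  · simp

/-- A telescoping sum over all of `Fin N` with an indicator, the shape in which `finiteRank`
produces it. -/
theorem sum_spiralIncr {E : Type*} [AddCommGroup E] (N : ℕ) {i : ℕ} (hi : i ≤ N) (y : ℕ → E) :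
    ∑ j : Fin N, (if (j : ℕ) < i then y (j + 1) - y j else 0) = y i - y 0 := by
  rw [Fin.sum_univ_eq_sum_range (fun j => if j < i then y (j + 1) - y j else 0) N,
    ← Finset.sum_range_sub, ← Finset.sum_filter]
  refine Finset.sum_congr ?_ fun _ _ => rfl
  ext j
  simp
  omega

theorem inner_spiralIncr_spiralPoint {N i : ℕ} (hi : i ≤ N) (j : Fin N) :
    inner ℝ (spiralIncr N j) (spiralPoint (i / N)) = if (j : ℕ) < i then (√N)⁻¹ else 0 := by
  have hN : 0 < N := j.pos
  have hN' : (0 : ℝ) < N := by exact_mod_cast hN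
  have hs : √(N : ℝ) ≠ 0 := (Real.sqrt_pos.2 hN').ne'
  have h := sum_spiralIncr N hi fun k => spiralPoint (k / N)
  simp only [Nat.cast_zero, zero_div, spiralPoint_zero, sub_zero] at h
  have h2 : spiralPoint (i / N) =
      ∑ j : Fin N, (if (j : ℕ) < i then (√N)⁻¹ else 0) • spiralIncr N j := by
    rw [← h]
    refine Finset.sum_congr rfl fun k _ => ?_
    split_ifs
    · rw [spiralIncr, inv_smul_smul₀ hs]
    · simp
  rw [h2, (orthonormal_spiralIncr N).inner_right_fintype]

/-- The contraction taking the spiral increments to `c • g` sends the spiral point at `i / N` to `c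
• x i`. With `u = ‖x i‖²` and `t = i / N`, the squared distance after dilation is `u + t - 2cu = (1
- 2c)(u - t) + 2(1 - c)t`. -/
theorem exists_isometries_dist_grid_le {N : ℕ} (hN : 0 < N) {x : ℕ → L2Seq} (hx0 : x 0 = 0)
    {δ : ℝ} (hδ : ∀ i ≤ N, ∀ j ≤ N, |‖x i - x j‖ ^ 2 - |(i : ℝ) - j| / N| ≤ δ) :
    ∃ Φ Ψ : L2Seq →ₗᵢ[ℝ] L2Seq,
      ∀ i ≤ N, ‖Φ (x i) - Ψ (spiralPoint (i / N))‖ ^ 2 ≤ (4 * (N : ℝ) ^ 2 + 1) * δ := by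
  have hN' : (0 : ℝ) < N := by exact_mod_cast hN
  have hs : √(N : ℝ) ≠ 0 := (Real.sqrt_pos.2 hN').ne'
  have hδ0 : 0 ≤ δ := (abs_nonneg _).trans (hδ 0 (Nat.zero_le _) 0 (Nat.zero_le _))
  -- Gram entries of `g` are off by at most `2 * N * δ`; Cauchy–Schwarz over `N` indices contributes
  -- another factor `N`.
  set η : ℝ := 2 * (N : ℝ) ^ 2 * δ with hη
  have hη0 : 0 ≤ η := by positivity
  set g : Fin N → L2Seq := fun i => √N • (x (i + 1) - x i) with hg
  have hgram : ∀ i j, |inner ℝ (g i) (g j) - if i = j then 1 else 0| ≤ 2 * N * δ := by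
    intro i j
    have h := four_point_inner (x i) (x (i + 1)) (x j) (x (j + 1))
    have h4 := @four_point_abs i j
    have e1 := abs_le.1 (hδ (i + 1) i.2 j j.2.le)
    have e2 := abs_le.1 (hδ i i.2.le (j + 1) j.2)
    have e3 := abs_le.1 (hδ (i + 1) i.2 (j + 1) j.2)
    have e4 := abs_le.1 (hδ i i.2.le j j.2.le)
    have h5 : inner ℝ (g i) (g j) = N * inner ℝ (x (i + 1) - x i) (x (j + 1) - x j) := by
      rw [hg, inner_smul_left, inner_smul_right]
      simp only [conj_trivial, ← mul_assoc, Real.mul_self_sqrt hN'.le]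
    have h6 : (if i = j then (1 : ℝ) else 0) = N * ((if (i : ℕ) = j then (2 : ℝ) else 0) / N / 2) := by
      simp only [Fin.ext_iff]
      split_ifs
      · field_simp
      · simp
    rw [h5, h6, ← mul_sub, abs_mul, abs_of_pos hN', mul_comm 2 (N : ℝ), mul_assoc]
    refine mul_le_mul_of_nonneg_left ?_ hN'.le
    rw [← h4, sub_div _ _ (N : ℝ), sub_div _ _ (N : ℝ), add_div _ _ (N : ℝ)]
    rw [abs_le]
    constructor <;> linarith
  have hT : ∀ ξ : Fin N → ℝ, ‖∑ i, ξ i • g i‖ ^ 2 ≤ (1 + η) * ∑ i, ξ i ^ 2 := by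
    intro ξ
    have h1 : ‖∑ i, ξ i • g i‖ ^ 2 - ∑ i, ξ i ^ 2 =
        ∑ i, ∑ j, ξ i * ξ j * (inner ℝ (g i) (g j) - if i = j then 1 else 0) := by
      simp only [mul_sub, Finset.sum_sub_distrib, mul_ite, mul_one, mul_zero,
        Finset.sum_ite_eq, Finset.mem_univ, if_true, ← sq]
      rw [← real_inner_self_eq_norm_sq, sum_inner]
      congr 1
      refine Finset.sum_congr rfl fun i _ => ?_
      rw [inner_sum]
      refine Finset.sum_congr rfl fun j _ => ?_
      rw [inner_smul_left, inner_smul_right, conj_trivial]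
      ring
    have h2 : ∑ i, ∑ j, ξ i * ξ j * (inner ℝ (g i) (g j) - if i = j then 1 else 0) ≤
        ∑ i, ∑ j, |ξ i| * |ξ j| * (2 * N * δ) := by
      refine Finset.sum_le_sum fun i _ => Finset.sum_le_sum fun j _ => ?_
      refine (le_abs_self _).trans ?_
      rw [abs_mul, abs_mul]
      exact mul_le_mul_of_nonneg_left (hgram i j) (by positivity)
    have h3 : ∑ i, ∑ j, |ξ i| * |ξ j| * (2 * N * δ) = (∑ i, |ξ i|) ^ 2 * (2 * N * δ) := by
      rw [sq, Finset.sum_mul_sum]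
      simp only [Finset.sum_mul]
    have h4 : (∑ i, |ξ i|) ^ 2 ≤ N * ∑ i, ξ i ^ 2 := by
      have := sq_sum_le_card_mul_sum_sq (s := Finset.univ) (f := fun i => |ξ i|)
      simpa using this
    have h5 : (∑ i, |ξ i|) ^ 2 * (2 * N * δ) ≤ N * (∑ i, ξ i ^ 2) * (2 * N * δ) :=
      mul_le_mul_of_nonneg_right h4 (by positivity)
    have h6 : N * (∑ i, ξ i ^ 2) * (2 * N * δ) = η * ∑ i, ξ i ^ 2 := by
      rw [hη]
      ring
    linarith
  set c : ℝ := √((1 + η)⁻¹) with hc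
  have hc2 : c ^ 2 * (1 + η) = 1 := by
    rw [hc, Real.sq_sqrt (by positivity), inv_mul_cancel₀ (by positivity)]
  have hc0 : 0 ≤ c := Real.sqrt_nonneg _
  have hc1 : c ≤ 1 := by nlinarith
  obtain ⟨Φ, Ψ, hΦΨ⟩ := exists_isometries_inner_eq (orthonormal_spiralIncr N)
    (g := fun i => c • g i) (fun ξ => by
      simp only [smul_comm _ c, ← Finset.smul_sum]
      rw [norm_smul, mul_pow, Real.norm_eq_abs, sq_abs]
      calc c ^ 2 * ‖∑ i, ξ i • g i‖ ^ 2 ≤ c ^ 2 * ((1 + η) * ∑ i, ξ i ^ 2) :=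
            mul_le_mul_of_nonneg_left (hT ξ) (sq_nonneg c)
        _ = ∑ i, ξ i ^ 2 := by rw [← mul_assoc, hc2, one_mul])
  refine ⟨Φ, Ψ, fun i hi => ?_⟩
  have hrank : finiteRank (spiralIncr N) (fun i => c • g i) (spiralPoint (i / N)) = c • x i := by
    have h := sum_spiralIncr N hi x
    rw [hx0, sub_zero] at h
    rw [finiteRank_apply, ← h, Finset.smul_sum]
    refine Finset.sum_congr rfl fun j _ => ?_
    rw [inner_spiralIncr_spiralPoint hi]
    split_ifs
    · rw [smul_comm, hg, inv_smul_smul₀ hs]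
    · simp
  have hw : ‖spiralPoint (i / N)‖ ^ 2 = i / N := by
    have := norm_spiralPoint_div_sub_sq hN hi (Nat.zero_le N)
    simpa [spiralPoint_zero] using this
  have hxi := hδ i hi 0 (Nat.zero_le _)
  rw [hx0, sub_zero, Nat.cast_zero, sub_zero, Nat.abs_cast] at hxi
  rw [norm_sub_sq_real, Φ.norm_map, Ψ.norm_map, hΦΨ, hrank, inner_smul_right,
    real_inner_self_eq_norm_sq, hw]
  set t : ℝ := i / N
  set u := ‖x i‖ ^ 2
  have ht := div_mem_Icc hN hi
  have ht0 : 0 ≤ t := ht.1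
  have ht1 : t ≤ 1 := ht.2
  obtain ⟨hl, hr⟩ := abs_le.1 hxi
  have hcc : c ^ 2 ≤ c := by nlinarith
  -- Indeed `1 - c ≤ 1 - c² = c²η ≤ η`.
  have hcη : 1 - c ≤ η := by nlinarith [mul_le_mul_of_nonneg_right (hcc.trans hc1) hη0]
  have h7 : (1 - 2 * c) * (u - t) ≤ δ := by
    have : |(1 - 2 * c) * (u - t)| ≤ 1 * δ := by
      rw [abs_mul]
      exact mul_le_mul (abs_le.2 ⟨by linarith, by linarith⟩) hxi (abs_nonneg _) zero_le_one
    linarith [le_abs_self ((1 - 2 * c) * (u - t))]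
  have h8 : (1 - c) * t ≤ η := by nlinarith
  have h9 : (4 * (N : ℝ) ^ 2 + 1) * δ = 2 * η + δ := by
    rw [hη]
    ring
  rw [h9]
  nlinarith

/-! ### The weak law of large numbers for squared norms -/

/-- Independent centered increments with uncorrelated components, whose squared norms have
expectation one and whose components have variance at most `v`. -/
structure IsIncrements {Ω : Type*} [MeasurableSpace Ω] {d : ℕ} (P : Measure Ω)
    (X : ℕ → Ω → EuclideanSpace ℝ (Fin d)) (v : ℝ) : Prop where
  meas : ∀ i, Measurable (X i)
  indep : iIndepFun X P
  mean : ∀ i, ∫ ω, X i ω ∂P = 0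
  norm_sq : ∀ i, ∫ ω, ‖X i ω‖ ^ 2 ∂P = 1
  uncor : ∀ i, ∀ j k : Fin d, j ≠ k → ∫ ω, X i ω j * X i ω k ∂P = 0
  var_le : ∀ i, ∀ k : Fin d, ∫ ω, X i ω k ^ 2 ∂P ≤ v
  nonneg : 0 ≤ v

/-- Twice the sum of the inner products of the different increments. -/
def crossSum {Ω : Type*} {d : ℕ} (X : ℕ → Ω → EuclideanSpace ℝ (Fin d)) (s : Finset ℕ)
    (ω : Ω) : ℝ :=
  ‖∑ i ∈ s, X i ω‖ ^ 2 - ∑ i ∈ s, ‖X i ω‖ ^ 2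

theorem crossSum_insert {Ω : Type*} {d : ℕ} {X : ℕ → Ω → EuclideanSpace ℝ (Fin d)}
    {s : Finset ℕ} {a : ℕ} (ha : a ∉ s) (ω : Ω) :
    crossSum X (insert a s) ω = crossSum X s ω + 2 * inner ℝ (∑ i ∈ s, X i ω) (X a ω) := by
  rw [crossSum, crossSum, Finset.sum_insert ha, Finset.sum_insert ha, add_comm (X a ω),
    norm_add_sq_real]
  ring

section Increments

variable {Ω : Type*} [MeasurableSpace Ω] {d : ℕ} {P : Measure Ω}

theorem memLp_coord {U : Ω → EuclideanSpace ℝ (Fin d)} (hU : MemLp U 2 P) (k : Fin d) :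
    MemLp (fun ω => U ω k) 2 P :=
  (EuclideanSpace.proj k : EuclideanSpace ℝ (Fin d) →L[ℝ] ℝ).comp_memLp' hU

theorem integrable_norm_sq_of_memLp {U : Ω → EuclideanSpace ℝ (Fin d)} (hU : MemLp U 2 P) :
    Integrable (fun ω => ‖U ω‖ ^ 2) P :=
  (memLp_two_iff_integrable_sq_norm hU.1).1 hU

theorem inner_eq_sum_coord (x y : EuclideanSpace ℝ (Fin d)) :
    inner ℝ x y = ∑ k, x k * y k := by
  simp [PiLp.inner_apply, mul_comm]

variable {U Z : Ω → EuclideanSpace ℝ (Fin d)}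

/-- Martingale orthogonality: `W • U` belongs to the past and `Z` is a centered new increment. It is
used with `W` the cross sum and with `W = 1`. -/
theorem integral_mul_inner_eq_zero [IsProbabilityMeasure P] {W : Ω → ℝ}
    (hind : IndepFun (fun ω => (W ω, U ω)) Z P)
    (hW : MemLp W 2 P) (hU : MemLp U 2 P) (hZ : MemLp Z 2 P) (hZ0 : ∫ ω, Z ω ∂P = 0) :
    ∫ ω, W ω * inner ℝ (U ω) (Z ω) ∂P = 0 := by
  have hZk : ∀ k, ∫ ω, Z ω k ∂P = 0 := by
    intro k
    have := (EuclideanSpace.proj k : EuclideanSpace ℝ (Fin d) →L[ℝ] ℝ).integral_comp_comm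
      (hZ.integrable one_le_two)
    simpa [hZ0] using this
  have hindk : ∀ k, IndepFun (fun ω => W ω * U ω k) (fun ω => Z ω k) P := fun k =>
    hind.comp (φ := fun p : ℝ × EuclideanSpace ℝ (Fin d) => p.1 * p.2 k)
      (ψ := fun z : EuclideanSpace ℝ (Fin d) => z k)
      (by fun_prop) (by fun_prop)
  have hint : ∀ k, Integrable (fun ω => W ω * U ω k) P := fun k =>
    hW.integrable_mul (memLp_coord hU k)
  have hZi : ∀ k, Integrable (fun ω => Z ω k) P := fun k =>
    (memLp_coord hZ k).integrable one_le_two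
  simp only [inner_eq_sum_coord, Finset.mul_sum, ← mul_assoc]
  have hmul : ∀ k, Integrable (fun ω => W ω * U ω k * Z ω k) P := fun k =>
    (hindk k).integrable_mul (hint k) (hZi k)
  rw [integral_finsetSum _ fun k _ => hmul k]
  refine Finset.sum_eq_zero fun k _ => ?_
  rw [(hindk k).integral_fun_mul_eq_mul_integral (hint k).1 (hZi k).1, hZk, mul_zero]

/-- Cauchy–Schwarz and independence make two moments enough; no fourth moments are needed. -/
theorem memLp_inner_of_indepFun (hind : IndepFun U Z P) (hU : MemLp U 2 P) (hZ : MemLp Z 2 P) :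
    MemLp (fun ω => inner ℝ (U ω) (Z ω)) 2 P := by
  have hn : IndepFun (fun ω => ‖U ω‖ ^ 2) (fun ω => ‖Z ω‖ ^ 2) P :=
    hind.comp (φ := fun z => ‖z‖ ^ 2) (ψ := fun z => ‖z‖ ^ 2) (by fun_prop) (by fun_prop)
  have hmeas : AEStronglyMeasurable (fun ω => inner ℝ (U ω) (Z ω)) P := hU.1.inner hZ.1
  rw [memLp_two_iff_integrable_sq hmeas]
  refine Integrable.mono'
    (hn.integrable_mul (integrable_norm_sq_of_memLp hU) (integrable_norm_sq_of_memLp hZ))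
    (hmeas.pow 2) (Eventually.of_forall fun ω => ?_)
  rw [Pi.mul_apply, ← mul_pow, Real.norm_eq_abs, abs_pow]
  exact pow_le_pow_left₀ (abs_nonneg _) (abs_real_inner_le_norm _ _) 2

/-- Independence factors the expanded square and uncorrelatedness leaves only the diagonal `∑ j,
E[U_j²] E[Z_j²]`. -/
theorem integral_inner_sq_le {v : ℝ} (hind : IndepFun U Z P) (hU : MemLp U 2 P)
    (hZ : MemLp Z 2 P) (huncor : ∀ j k : Fin d, j ≠ k → ∫ ω, Z ω j * Z ω k ∂P = 0)
    (hvar : ∀ k : Fin d, ∫ ω, Z ω k ^ 2 ∂P ≤ v) :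
    ∫ ω, inner ℝ (U ω) (Z ω) ^ 2 ∂P ≤ v * ∫ ω, ‖U ω‖ ^ 2 ∂P := by
  have hindk : ∀ j k, IndepFun (fun ω => U ω j * U ω k) (fun ω => Z ω j * Z ω k) P := fun j k =>
    hind.comp (φ := fun z : EuclideanSpace ℝ (Fin d) => z j * z k)
      (ψ := fun z : EuclideanSpace ℝ (Fin d) => z j * z k) (by fun_prop) (by fun_prop)
  have hUi : ∀ j k, Integrable (fun ω => U ω j * U ω k) P := fun j k =>
    (memLp_coord hU j).integrable_mul (memLp_coord hU k)
  have hZi : ∀ j k, Integrable (fun ω => Z ω j * Z ω k) P := fun j k =>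
    (memLp_coord hZ j).integrable_mul (memLp_coord hZ k)
  have hexp : ∀ ω, inner ℝ (U ω) (Z ω) ^ 2 = ∑ j, ∑ k, U ω j * U ω k * (Z ω j * Z ω k) := by
    intro ω
    rw [inner_eq_sum_coord, sq, Finset.sum_mul_sum]
    exact Finset.sum_congr rfl fun j _ => Finset.sum_congr rfl fun k _ => by ring
  have hint : ∀ j k, Integrable (fun ω => U ω j * U ω k * (Z ω j * Z ω k)) P := fun j k =>
    (hindk j k).integrable_mul (hUi j k) (hZi j k)
  simp only [hexp]
  rw [integral_finsetSum _ fun j _ => integrable_finsetSum _ fun k _ => hint j k]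
  have hdiag : ∀ j, ∫ ω, ∑ k, U ω j * U ω k * (Z ω j * Z ω k) ∂P =
      (∫ ω, U ω j ^ 2 ∂P) * ∫ ω, Z ω j ^ 2 ∂P := by
    intro j
    rw [integral_finsetSum _ fun k _ => hint j k, Finset.sum_eq_single j]
    · rw [(hindk j j).integral_fun_mul_eq_mul_integral (hUi j j).1 (hZi j j).1]
      simp only [sq]
    · intro k _ hk
      rw [(hindk j k).integral_fun_mul_eq_mul_integral (hUi j k).1 (hZi j k).1,
        huncor j k hk.symm, mul_zero]
    · simp
  simp only [hdiag, EuclideanSpace.real_norm_sq_eq]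
  rw [integral_finsetSum _ fun j _ => (memLp_coord hU j).integrable_sq, Finset.mul_sum]
  refine Finset.sum_le_sum fun j _ => ?_
  rw [mul_comm]
  exact mul_le_mul_of_nonneg_right (hvar j) (integral_nonneg fun ω => sq_nonneg _)

variable {X : ℕ → Ω → EuclideanSpace ℝ (Fin d)} {v : ℝ}

theorem IsIncrements.integrable_norm_sq (hX : IsIncrements P X v) (i : ℕ) :
    Integrable (fun ω => ‖X i ω‖ ^ 2) P := by
  -- A non-integrable function has integral zero by convention, whereas this integral is one.
  by_contra h
  exact zero_ne_one ((integral_undef h).symm.trans (hX.norm_sq i))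

theorem IsIncrements.memLp (hX : IsIncrements P X v) (i : ℕ) : MemLp (X i) 2 P :=
  (memLp_two_iff_integrable_sq_norm (hX.meas i).aestronglyMeasurable).2 (hX.integrable_norm_sq i)

theorem IsIncrements.memLp_sum (hX : IsIncrements P X v) (s : Finset ℕ) :
    MemLp (fun ω => ∑ i ∈ s, X i ω) 2 P :=
  memLp_finsetSum s fun i _ => hX.memLp i

theorem IsIncrements.indepFun_crossSum (hX : IsIncrements P X v) {s : Finset ℕ} {a : ℕ}
    (ha : a ∉ s) : IndepFun (fun ω => (crossSum X s ω, ∑ i ∈ s, X i ω)) (X a) P := by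
  have h := hX.indep.indepFun_finset s {a} (Finset.disjoint_singleton_right.2 ha) hX.meas
  have hψ : Measurable fun y : ({a} : Finset ℕ) → EuclideanSpace ℝ (Fin d) =>
      y ⟨a, Finset.mem_singleton_self a⟩ := measurable_pi_apply _
  have h2 := h.comp
    (φ := fun y : s → EuclideanSpace ℝ (Fin d) => (‖∑ i, y i‖ ^ 2 - ∑ i, ‖y i‖ ^ 2, ∑ i, y i))
    (by fun_prop) hψ
  convert! h2 using 1
  funext ω
  simp only [Function.comp_apply, crossSum]
  rw [Finset.sum_coe_sort s fun i => X i ω, Finset.sum_coe_sort s fun i => ‖X i ω‖ ^ 2]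

/-- A new increment adds to the cross sum a term orthogonal to it, with second moment at most `4 * v
* s.card`; the induction closes since `2m² + 4m ≤ 2(m + 1)²`. -/
theorem IsIncrements.crossSum_moments [IsProbabilityMeasure P] (hX : IsIncrements P X v)
    (s : Finset ℕ) : MemLp (crossSum X s) 2 P ∧ ∫ ω, ‖∑ i ∈ s, X i ω‖ ^ 2 ∂P = s.card ∧
      ∫ ω, crossSum X s ω ^ 2 ∂P ≤ 2 * v * (s.card : ℝ) ^ 2 := by
  induction s using Finset.induction_on with
  | empty =>
    have : crossSum X (∅ : Finset ℕ) = fun _ => 0 := by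
      funext ω
      simp [crossSum]
    rw [this]
    simp
  | insert a s ha ih =>
    obtain ⟨hQ, hS, hQv⟩ := ih
    have hind := hX.indepFun_crossSum ha
    have hindS : IndepFun (fun ω => ∑ i ∈ s, X i ω) (X a) P :=
      hind.comp (φ := Prod.snd) (ψ := id) measurable_snd measurable_id
    have hindC : IndepFun (fun ω => ((1 : ℝ), ∑ i ∈ s, X i ω)) (X a) P :=
      hind.comp (φ := fun p => ((1 : ℝ), p.2)) (ψ := id) (by fun_prop) measurable_id
    have hU := hX.memLp_sum s
    have hT := memLp_inner_of_indepFun hindS hU (hX.memLp a)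
    have h0 := integral_mul_inner_eq_zero hind hQ hU (hX.memLp a) (hX.mean a)
    have h1 := integral_mul_inner_eq_zero hindC (memLp_const 1) hU (hX.memLp a) (hX.mean a)
    have h2 := integral_inner_sq_le hindS hU (hX.memLp a) (hX.uncor a) (hX.var_le a)
    simp only [one_mul] at h1
    rw [hS] at h2
    have hcs : crossSum X (insert a s) =
        fun ω => crossSum X s ω + 2 * inner ℝ (∑ i ∈ s, X i ω) (X a ω) :=
      funext fun ω => crossSum_insert ha ω
    have hv := hX.nonneg
    rw [Finset.card_insert_of_notMem ha, hcs]
    push_cast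
    refine ⟨hQ.add (hT.const_mul 2), ?_, ?_⟩
    · have : ∀ ω, ‖∑ i ∈ insert a s, X i ω‖ ^ 2 = ‖∑ i ∈ s, X i ω‖ ^ 2 +
          2 * inner ℝ (∑ i ∈ s, X i ω) (X a ω) + ‖X a ω‖ ^ 2 := by
        intro ω
        rw [Finset.sum_insert ha, add_comm (X a ω), norm_add_sq_real]
      simp only [this]
      have hTi := (hT.integrable one_le_two).const_mul 2
      have hsum : Integrable (fun ω => ‖∑ i ∈ s, X i ω‖ ^ 2 +
          2 * inner ℝ (∑ i ∈ s, X i ω) (X a ω)) P := (integrable_norm_sq_of_memLp hU).add hTi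
      rw [integral_add hsum (hX.integrable_norm_sq a),
        integral_add (integrable_norm_sq_of_memLp hU) hTi, integral_const_mul, h1, hS, hX.norm_sq a]
      ring
    · have : ∀ ω, (crossSum X s ω + 2 * inner ℝ (∑ i ∈ s, X i ω) (X a ω)) ^ 2 =
          crossSum X s ω ^ 2 + 4 * (crossSum X s ω * inner ℝ (∑ i ∈ s, X i ω) (X a ω)) +
            4 * inner ℝ (∑ i ∈ s, X i ω) (X a ω) ^ 2 := fun ω => by ring
      simp only [this]
      have hQT : Integrable
          (fun ω => 4 * (crossSum X s ω * inner ℝ (∑ i ∈ s, X i ω) (X a ω))) P :=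
        (hQ.integrable_mul hT).const_mul 4
      have hTT := hT.integrable_sq.const_mul 4
      have hsum : Integrable (fun ω => crossSum X s ω ^ 2 +
          4 * (crossSum X s ω * inner ℝ (∑ i ∈ s, X i ω) (X a ω))) P := hQ.integrable_sq.add hQT
      rw [integral_add hsum hTT, integral_add hQ.integrable_sq hQT,
        integral_const_mul, integral_const_mul, h0]
      nlinarith

theorem IsIncrements.measureReal_crossSum_le [IsProbabilityMeasure P] (hX : IsIncrements P X v)
    {s : Finset ℕ} {n : ℕ}
    (hn : 1 ≤ n) (hs : s.card ≤ n) {ε : ℝ} (hε : 0 < ε) :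
    P.real {ω | ε * n ≤ |crossSum X s ω|} ≤ 2 * v / ε ^ 2 := by
  obtain ⟨hQ, -, hQv⟩ := hX.crossSum_moments s
  have hn' : (0 : ℝ) < n := by exact_mod_cast hn
  have h := mul_meas_ge_le_integral_of_nonneg
    (Eventually.of_forall fun ω => sq_nonneg (crossSum X s ω)) hQ.integrable_sq ((ε * n) ^ 2)
  have hset : {ω | ε * n ≤ |crossSum X s ω|} = {ω | (ε * n) ^ 2 ≤ crossSum X s ω ^ 2} := by
    ext ω
    change ε * n ≤ |crossSum X s ω| ↔ (ε * n) ^ 2 ≤ crossSum X s ω ^ 2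
    rw [sq_le_sq, abs_of_nonneg (by positivity : 0 ≤ ε * n)]
  have hcard : (s.card : ℝ) ^ 2 ≤ (n : ℝ) ^ 2 := by
    have : (s.card : ℝ) ≤ n := by exact_mod_cast hs
    gcongr
  have hv := hX.nonneg
  rw [hset, le_div_iff₀ (by positivity)]
  have h3 : (n : ℝ) ^ 2 * (P.real {ω | (ε * n) ^ 2 ≤ crossSum X s ω ^ 2} * ε ^ 2) ≤
      (n : ℝ) ^ 2 * (2 * v) := by
    calc (n : ℝ) ^ 2 * (P.real {ω | (ε * n) ^ 2 ≤ crossSum X s ω ^ 2} * ε ^ 2)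
        = (ε * n) ^ 2 * P.real {ω | (ε * n) ^ 2 ≤ crossSum X s ω ^ 2} := by ring
      _ ≤ 2 * v * (s.card : ℝ) ^ 2 := h.trans hQv
      _ ≤ 2 * v * (n : ℝ) ^ 2 := by gcongr
      _ = (n : ℝ) ^ 2 * (2 * v) := by ring
  exact le_of_mul_le_mul_left h3 (by positivity)

/-- The squared norm of an increment, truncated at level `A`. -/
def truncSq (A : ℝ) (x : EuclideanSpace ℝ (Fin d)) : ℝ := if ‖x‖ ^ 2 ≤ A then ‖x‖ ^ 2 else 0

theorem measurable_truncSq (A : ℝ) :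
    Measurable (truncSq A : EuclideanSpace ℝ (Fin d) → ℝ) :=
  Measurable.ite (measurableSet_le (by fun_prop) measurable_const) (by fun_prop) measurable_const

theorem truncSq_nonneg (A : ℝ) (x : EuclideanSpace ℝ (Fin d)) : 0 ≤ truncSq A x := by
  unfold truncSq
  split_ifs <;> positivity

theorem truncSq_le (A : ℝ) (x : EuclideanSpace ℝ (Fin d)) : truncSq A x ≤ ‖x‖ ^ 2 := by
  unfold truncSq
  split_ifs
  exacts [le_rfl, by positivity]

theorem truncSq_sq_le {A : ℝ} (hA : 0 ≤ A) (x : EuclideanSpace ℝ (Fin d)) :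
    truncSq A x ^ 2 ≤ A * ‖x‖ ^ 2 := by
  unfold truncSq
  split_ifs with h
  · rw [sq (‖x‖ ^ 2)]
    gcongr
  · rw [zero_pow two_ne_zero]
    positivity

theorem IsIncrements.memLp_truncSq (hX : IsIncrements P X v) {A : ℝ} (hA : 0 ≤ A) (i : ℕ) :
    MemLp (fun ω => truncSq A (X i ω)) 2 P := by
  have hm : AEStronglyMeasurable (fun ω => truncSq A (X i ω)) P :=
    ((measurable_truncSq A).comp (hX.meas i)).aestronglyMeasurable
  rw [memLp_two_iff_integrable_sq hm]
  refine Integrable.mono' ((hX.integrable_norm_sq i).const_mul A) (hm.pow 2)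
    (Eventually.of_forall fun ω => ?_)
  rw [Real.norm_eq_abs, abs_of_nonneg (sq_nonneg _)]
  exact truncSq_sq_le hA _

theorem IsIncrements.variance_truncSq_le [IsProbabilityMeasure P] (hX : IsIncrements P X v) {A : ℝ}
    (hA : 0 ≤ A) (i : ℕ) : variance (fun ω => truncSq A (X i ω)) P ≤ A := by
  have hm := hX.memLp_truncSq hA i
  calc variance (fun ω => truncSq A (X i ω)) P
      ≤ ∫ ω, truncSq A (X i ω) ^ 2 ∂P := variance_le_expectation_sq hm.1
    _ ≤ ∫ ω, A * ‖X i ω‖ ^ 2 ∂P :=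
        integral_mono hm.integrable_sq ((hX.integrable_norm_sq i).const_mul A)
          fun ω => truncSq_sq_le hA _
    _ = A := by rw [integral_const_mul, hX.norm_sq i, mul_one]

theorem IsIncrements.measureReal_truncSq_le [IsProbabilityMeasure P] (hX : IsIncrements P X v) {A : ℝ} (hA : 0 ≤ A)
    {s : Finset ℕ} {n : ℕ} (hn : 1 ≤ n) (hs : s.card ≤ n) {ε : ℝ} (hε : 0 < ε) :
    P.real {ω | ε * n ≤ |∑ i ∈ s, truncSq A (X i ω) -
      ∑ i ∈ s, ∫ ω, truncSq A (X i ω) ∂P|} ≤ A / (n * ε ^ 2) := by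
  have hn' : (0 : ℝ) < n := by exact_mod_cast hn
  have hm := fun i => hX.memLp_truncSq hA i
  have hsum : MemLp (∑ i ∈ s, fun ω => truncSq A (X i ω)) 2 P :=
    memLp_finsetSum' s fun i _ => hm i
  have hcheb := meas_ge_le_variance_div_sq hsum (by positivity : 0 < ε * n)
  have hvar : variance (∑ i ∈ s, fun ω => truncSq A (X i ω)) P ≤ n * A := by
    rw [IndepFun.variance_sum (fun i _ => hm i) fun i _ j _ hij =>
      (hX.indep.indepFun hij).comp (measurable_truncSq A) (measurable_truncSq A)]
    calc ∑ i ∈ s, variance (fun ω => truncSq A (X i ω)) P ≤ ∑ _i ∈ s, A :=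
          Finset.sum_le_sum fun i _ => hX.variance_truncSq_le hA i
      _ = s.card * A := by rw [Finset.sum_const, nsmul_eq_mul]
      _ ≤ n * A := by gcongr
  have hmean : ∫ ω, (∑ i ∈ s, fun ω => truncSq A (X i ω)) ω ∂P =
      ∑ i ∈ s, ∫ ω, truncSq A (X i ω) ∂P := by
    simp only [Finset.sum_apply]
    exact integral_finsetSum _ fun i _ => (hm i).integrable one_le_two
  rw [hmean] at hcheb
  simp only [Finset.sum_apply] at hcheb
  refine (ENNReal.toReal_mono ENNReal.ofReal_ne_top hcheb).trans ?_
  rw [ENNReal.toReal_ofReal (div_nonneg (variance_nonneg _ _) (sq_nonneg _))]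
  calc variance (∑ i ∈ s, fun ω => truncSq A (X i ω)) P / (ε * n) ^ 2
      ≤ n * A / (ε * n) ^ 2 := by gcongr
    _ = A / (n * ε ^ 2) := by field_simp

/-- The tail part may lack a variance, so Markov replaces Chebyshev: for `Y ≥ 0`, `|Y - E Y| ≤ Y + E
Y`, whose mean is at most `2 * n * η`. -/
theorem IsIncrements.measureReal_tail_le [IsProbabilityMeasure P] (hX : IsIncrements P X v) {A η : ℝ}
    (htail : ∀ i, ∫ ω, (‖X i ω‖ ^ 2 - truncSq A (X i ω)) ∂P ≤ η)
    {s : Finset ℕ} {n : ℕ} (hn : 1 ≤ n) (hs : s.card ≤ n) {ε : ℝ} (hε : 0 < ε) :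
    P.real {ω | ε * n ≤ |∑ i ∈ s, (‖X i ω‖ ^ 2 - truncSq A (X i ω)) -
      ∑ i ∈ s, ∫ ω, (‖X i ω‖ ^ 2 - truncSq A (X i ω)) ∂P|} ≤ 2 * η / ε := by
  have hn' : (0 : ℝ) < n := by exact_mod_cast hn
  have hz : ∀ i ω, 0 ≤ ‖X i ω‖ ^ 2 - truncSq A (X i ω) := fun i ω =>
    sub_nonneg.2 (truncSq_le A _)
  have hη : 0 ≤ η := (integral_nonneg (hz 0)).trans (htail 0)
  have hint : ∀ i, Integrable (fun ω => ‖X i ω‖ ^ 2 - truncSq A (X i ω)) P := by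
    intro i
    refine (hX.integrable_norm_sq i).sub (Integrable.mono' (hX.integrable_norm_sq i)
      ((measurable_truncSq A).comp (hX.meas i)).aestronglyMeasurable
      (Eventually.of_forall fun ω => ?_))
    rw [Real.norm_eq_abs, abs_of_nonneg (truncSq_nonneg A _)]
    exact truncSq_le A _
  have hsum : Integrable (fun ω => ∑ i ∈ s, (‖X i ω‖ ^ 2 - truncSq A (X i ω))) P :=
    integrable_finsetSum _ fun i _ => hint i
  have hc0 : 0 ≤ ∑ i ∈ s, ∫ ω, (‖X i ω‖ ^ 2 - truncSq A (X i ω)) ∂P :=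
    Finset.sum_nonneg fun i _ => integral_nonneg (hz i)
  have hs0 : ∀ ω, 0 ≤ ∑ i ∈ s, (‖X i ω‖ ^ 2 - truncSq A (X i ω)) := fun ω =>
    Finset.sum_nonneg fun i _ => hz i ω
  have hc1 : ∑ i ∈ s, ∫ ω, (‖X i ω‖ ^ 2 - truncSq A (X i ω)) ∂P ≤ n * η := by
    refine (Finset.sum_le_sum fun i _ => htail i).trans ?_
    rw [Finset.sum_const, nsmul_eq_mul]
    gcongr
  have hmarkov := mul_meas_ge_le_integral_of_nonneg
    (Eventually.of_forall fun ω => add_nonneg (hs0 ω) hc0) (hsum.add (integrable_const _)) (ε * n)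
  rw [integral_add hsum (integrable_const _), integral_finsetSum _ fun i _ => hint i,
    integral_const, probReal_univ, one_smul] at hmarkov
  have hmono : P.real {ω | ε * n ≤ |∑ i ∈ s, (‖X i ω‖ ^ 2 - truncSq A (X i ω)) -
      ∑ i ∈ s, ∫ ω, (‖X i ω‖ ^ 2 - truncSq A (X i ω)) ∂P|} ≤
      P.real {ω | ε * n ≤ ∑ i ∈ s, (‖X i ω‖ ^ 2 - truncSq A (X i ω)) +
        ∑ i ∈ s, ∫ ω, (‖X i ω‖ ^ 2 - truncSq A (X i ω)) ∂P} := by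
    refine measureReal_mono fun ω hω => ?_
    rw [Set.mem_ofPred_eq] at hω ⊢
    refine hω.trans ?_
    rw [abs_le]
    constructor <;> linarith [hs0 ω]
  rw [le_div_iff₀ hε]
  have h3 : (n : ℝ) * (P.real {ω | ε * n ≤ |∑ i ∈ s, (‖X i ω‖ ^ 2 - truncSq A (X i ω)) -
      ∑ i ∈ s, ∫ ω, (‖X i ω‖ ^ 2 - truncSq A (X i ω)) ∂P|} * ε) ≤ n * (2 * η) := by
    have := mul_le_mul_of_nonneg_left hmono (by positivity : 0 ≤ ε * n)
    linarith
  exact le_of_mul_le_mul_left h3 hn'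

/-- The deviation splits into cross sum, centered truncated squares and centered tails; the factor 3
shares it among them. -/
theorem IsIncrements.measureReal_abs_norm_sq_sub_card_le [IsProbabilityMeasure P]
    (hX : IsIncrements P X v) {A η : ℝ}
    (hA : 0 ≤ A) (htail : ∀ i, ∫ ω, (‖X i ω‖ ^ 2 - truncSq A (X i ω)) ∂P ≤ η)
    {s : Finset ℕ} {n : ℕ} (hn : 1 ≤ n) (hs : s.card ≤ n) {ε : ℝ} (hε : 0 < ε) :
    P.real {ω | 3 * ε * n ≤ |‖∑ i ∈ s, X i ω‖ ^ 2 - s.card|} ≤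
      2 * v / ε ^ 2 + A / (n * ε ^ 2) + 2 * η / ε := by
  have h1 := hX.measureReal_crossSum_le hn hs hε
  have h2 := hX.measureReal_truncSq_le hA hn hs hε
  have h3 := hX.measureReal_tail_le htail hn hs hε
  refine le_trans ?_ (add_le_add (add_le_add h1 h2) h3)
  refine le_trans (measureReal_mono fun ω hω => ?_)
    ((measureReal_union_le _ _).trans (add_le_add_left (measureReal_union_le _ _) _))
  by_contra hcon
  simp only [Set.mem_union, Set.mem_ofPred_eq, not_or, not_le] at hcon
  obtain ⟨⟨hQ, hY⟩, hZ⟩ := hcon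
  have hmean : ∑ i ∈ s, ∫ ω, truncSq A (X i ω) ∂P +
      ∑ i ∈ s, ∫ ω, (‖X i ω‖ ^ 2 - truncSq A (X i ω)) ∂P = s.card := by
    rw [← Finset.sum_add_distrib]
    have : ∀ i ∈ s, ∫ ω, truncSq A (X i ω) ∂P +
        ∫ ω, (‖X i ω‖ ^ 2 - truncSq A (X i ω)) ∂P = 1 := by
      intro i _
      rw [integral_sub (hX.integrable_norm_sq i) ((hX.memLp_truncSq hA i).integrable one_le_two),
        hX.norm_sq i]
      ring
    rw [Finset.sum_congr rfl this]
    simp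
  have hdec : ‖∑ i ∈ s, X i ω‖ ^ 2 - s.card = crossSum X s ω +
      (∑ i ∈ s, truncSq A (X i ω) - ∑ i ∈ s, ∫ ω, truncSq A (X i ω) ∂P) +
      (∑ i ∈ s, (‖X i ω‖ ^ 2 - truncSq A (X i ω)) -
        ∑ i ∈ s, ∫ ω, (‖X i ω‖ ^ 2 - truncSq A (X i ω)) ∂P) := by
    rw [← hmean, crossSum, Finset.sum_sub_distrib (s := s) (fun i => ‖X i ω‖ ^ 2)]
    ring
  rw [Set.mem_ofPred_eq, hdec] at hω
  have := (abs_add_le _ _).trans (add_le_add_left (abs_add_le (crossSum X s ω)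
    (∑ i ∈ s, truncSq A (X i ω) - ∑ i ∈ s, ∫ ω, truncSq A (X i ω) ∂P))
    |∑ i ∈ s, (‖X i ω‖ ^ 2 - truncSq A (X i ω)) -
        ∑ i ∈ s, ∫ ω, (‖X i ω‖ ^ 2 - truncSq A (X i ω)) ∂P|)
  linarith

end Increments

/-! ### Ottaviani's inequality -/

section Ottaviani

theorem measurableSet_forall_lt_le {α : Type*} [MeasurableSpace α] {f : ℕ → α → ℝ}
    (hf : ∀ j, Measurable (f j)) (k : ℕ) (c : ℝ) : MeasurableSet {x | ∀ j < k, f j x ≤ c} := by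
  have : {x | ∀ j < k, f j x ≤ c} = ⋂ j, ⋂ _ : j < k, {x | f j x ≤ c} := by
    ext x
    simp
  rw [this]
  exact MeasurableSet.iInter fun j => MeasurableSet.iInter fun _ =>
    measurableSet_le (hf j) measurable_const

variable {Ω E : Type*} [MeasurableSpace Ω] {P : Measure Ω} [NormedAddCommGroup E]
  [MeasurableSpace E] [BorelSpace E] [SecondCountableTopology E] {X : ℕ → Ω → E}

/-- The event that the partial sum of the `k` increments from time `a` on is the first one whose
norm exceeds `c`. -/
def firstExceed (X : ℕ → Ω → E) (a : ℕ) (c : ℝ) (k : ℕ) : Set Ω :=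
  {ω | c < ‖∑ i ∈ Finset.Ico a (a + k), X i ω‖ ∧
    ∀ j < k, ‖∑ i ∈ Finset.Ico a (a + j), X i ω‖ ≤ c}

theorem measurableSet_firstExceed (hX : ∀ i, Measurable (X i)) (a : ℕ) (c : ℝ) (k : ℕ) :
    MeasurableSet (firstExceed X a c k) := by
  have hs : ∀ j, Measurable fun ω => ‖∑ i ∈ Finset.Ico a (a + j), X i ω‖ := by
    intro j
    fun_prop
  exact (measurableSet_lt measurable_const (hs k)).inter (measurableSet_forall_lt_le hs k c)

theorem measure_firstExceed_inter [IsProbabilityMeasure P] (hX : ∀ i, Measurable (X i))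
    (hind : iIndepFun X P) (a m k : ℕ) (c r : ℝ) :
    P.real (firstExceed X a c k ∩ {ω | ‖∑ i ∈ Finset.Ico (a + k) (a + m), X i ω‖ ≤ r}) =
      P.real (firstExceed X a c k) *
        P.real {ω | ‖∑ i ∈ Finset.Ico (a + k) (a + m), X i ω‖ ≤ r} := by
  have h := hind.indepFun_finset (Finset.Ico a (a + k)) (Finset.Ico (a + k) (a + m))
    (Finset.Ico_disjoint_Ico_consecutive _ _ _) hX
  -- All partial sums up to `k` become functions of the same block of increments, so the
  -- first-exceedance event is determined by that block.
  set ψ : ℕ → (Finset.Ico a (a + k) → E) → E :=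
    fun j y => ∑ i : Finset.Ico a (a + k), if (i : ℕ) < a + j then y i else 0
  have hψm : ∀ j, Measurable (ψ j) := by
    intro j
    refine Finset.measurable_sum _ fun i _ => ?_
    split_ifs
    exacts [measurable_pi_apply i, measurable_const]
  have hψ : ∀ j ≤ k, ∀ ω, ψ j (fun i => X i ω) = ∑ i ∈ Finset.Ico a (a + j), X i ω := by
    intro j hj ω
    simp only [ψ]
    rw [Finset.sum_coe_sort (Finset.Ico a (a + k)) fun i => if i < a + j then X i ω else 0,
      ← Finset.sum_filter]
    refine Finset.sum_congr ?_ fun _ _ => rfl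
    ext i
    simp only [Finset.mem_filter, Finset.mem_Ico]
    omega
  set A : Set (Finset.Ico a (a + k) → E) := {y | c < ‖ψ k y‖ ∧ ∀ j < k, ‖ψ j y‖ ≤ c}
  have hA : MeasurableSet A := by
    exact (measurableSet_lt measurable_const (hψm k).norm).inter
      (measurableSet_forall_lt_le (fun j => (hψm j).norm) k c)
  set B : Set (Finset.Ico (a + k) (a + m) → E) := {y | ‖∑ i, y i‖ ≤ r}
  have hB : MeasurableSet B := by
    have : Measurable fun y : Finset.Ico (a + k) (a + m) → E => ‖∑ i, y i‖ := by fun_prop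
    exact measurableSet_le this measurable_const
  have hpA : (fun ω (i : Finset.Ico a (a + k)) => X i ω) ⁻¹' A = firstExceed X a c k := by
    ext ω
    simp only [A, firstExceed, Set.mem_preimage, Set.mem_ofPred_eq, hψ k le_rfl ω]
    refine and_congr_right fun _ => forall_congr' fun j => forall_congr' fun hj => ?_
    rw [hψ j hj.le]
  have hpB : (fun ω (i : Finset.Ico (a + k) (a + m)) => X i ω) ⁻¹' B =
      {ω | ‖∑ i ∈ Finset.Ico (a + k) (a + m), X i ω‖ ≤ r} := by
    ext ω
    simp only [B, Set.mem_preimage, Set.mem_ofPred_eq]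
    rw [Finset.sum_coe_sort (Finset.Ico (a + k) (a + m)) fun i => X i ω]
  have := h.measure_inter_preimage_eq_mul A B hA hB
  rw [hpA, hpB] at this
  rw [measureReal_def, this, ENNReal.toReal_mul]
  rfl

/-- If `2 * c` is first exceeded at `k` and the remaining sum is at most `c`, the total exceeds `c`.
The remaining sum is independent of the past and obeys this bound with probability at least one
half; the first-exceedance events are disjoint. -/
theorem ottaviani [IsProbabilityMeasure P] (hX : ∀ i, Measurable (X i))
    (hind : iIndepFun X P) (a m : ℕ) {c : ℝ}
    (hc : ∀ k ≤ m, P.real {ω | c < ‖∑ i ∈ Finset.Ico (a + k) (a + m), X i ω‖} ≤ 1 / 2) :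
    P.real {ω | ∃ k ≤ m, 2 * c < ‖∑ i ∈ Finset.Ico a (a + k), X i ω‖} ≤
      2 * P.real {ω | c < ‖∑ i ∈ Finset.Ico a (a + m), X i ω‖} := by
  classical
  set A := firstExceed X a (2 * c)
  set B : ℕ → Set Ω := fun k => {ω | ‖∑ i ∈ Finset.Ico (a + k) (a + m), X i ω‖ ≤ c}
  have hAm : ∀ k, MeasurableSet (A k) := measurableSet_firstExceed hX a (2 * c)
  have hBm : ∀ k, MeasurableSet (B k) := by
    intro k
    have : Measurable fun ω => ‖∑ i ∈ Finset.Ico (a + k) (a + m), X i ω‖ := by fun_prop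
    exact measurableSet_le this measurable_const
  have hcover : {ω | ∃ k ≤ m, 2 * c < ‖∑ i ∈ Finset.Ico a (a + k), X i ω‖} ⊆
      ⋃ k ∈ Finset.range (m + 1), A k := by
    intro ω hω
    rw [Set.mem_ofPred_eq] at hω
    have hω' : ∃ k, 2 * c < ‖∑ i ∈ Finset.Ico a (a + k), X i ω‖ := hω.imp fun _ h => h.2
    obtain ⟨k, hkm, hk⟩ := hω
    refine Set.mem_biUnion (x := Nat.find hω') ?_
      ⟨Nat.find_spec hω', fun j hj => not_lt.1 (Nat.find_min hω' hj)⟩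
    exact Finset.mem_coe.2
      (Finset.mem_range.2 (Nat.lt_succ_of_le ((Nat.find_min' hω' hk).trans hkm)))
  have hdisj : ∀ i j, i < j → Disjoint (A i) (A j) := by
    intro i j hij
    rw [Set.disjoint_left]
    intro ω hi hj
    exact absurd hi.1 (not_lt.2 (hj.2 i hij))
  have hsub : ⋃ k ∈ Finset.range (m + 1), A k ∩ B k ⊆
      {ω | c < ‖∑ i ∈ Finset.Ico a (a + m), X i ω‖} := by
    intro ω hω
    simp only [Set.mem_iUnion] at hω
    obtain ⟨k, hk, hA, hB⟩ := hω
    have hkm : k ≤ m := Nat.lt_succ_iff.1 (Finset.mem_range.1 hk)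
    have hsum := Finset.sum_Ico_consecutive (fun i => X i ω) (Nat.le_add_right a k)
      (Nat.add_le_add_left hkm a)
    have h1 := hA.1
    rw [Set.mem_ofPred_eq] at hB
    rw [Set.mem_ofPred_eq, ← hsum]
    have h2 := norm_sub_le
      (∑ i ∈ Finset.Ico a (a + k), X i ω + ∑ i ∈ Finset.Ico (a + k) (a + m), X i ω)
      (∑ i ∈ Finset.Ico (a + k) (a + m), X i ω)
    rw [add_sub_cancel_right] at h2
    linarith
  have hhalf : ∀ k ∈ Finset.range (m + 1), P.real (A k) ≤ 2 * P.real (A k ∩ B k) := by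
    intro k hk
    have hkm : k ≤ m := Nat.lt_succ_iff.1 (Finset.mem_range.1 hk)
    have hBc : (B k)ᶜ = {ω | c < ‖∑ i ∈ Finset.Ico (a + k) (a + m), X i ω‖} := by
      ext ω
      simp [B]
    have h1 := probReal_compl_eq_one_sub (μ := P) (hBm k)
    rw [hBc] at h1
    have h2 := hc k hkm
    rw [measure_firstExceed_inter hX hind a m k (2 * c) c]
    have h3 : (1 : ℝ) / 2 ≤ P.real (B k) := by linarith
    nlinarith [measureReal_nonneg (μ := P) (s := A k)]
  calc P.real {ω | ∃ k ≤ m, 2 * c < ‖∑ i ∈ Finset.Ico a (a + k), X i ω‖}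
      ≤ P.real (⋃ k ∈ Finset.range (m + 1), A k) := measureReal_mono hcover (measure_ne_top _ _)
    _ ≤ ∑ k ∈ Finset.range (m + 1), P.real (A k) := measureReal_biUnion_finset_le _ _
    _ ≤ ∑ k ∈ Finset.range (m + 1), 2 * P.real (A k ∩ B k) := Finset.sum_le_sum hhalf
    _ = 2 * P.real (⋃ k ∈ Finset.range (m + 1), A k ∩ B k) := by
        rw [← Finset.mul_sum, measureReal_biUnion_finset]
        · intro i _ j _ hij
          refine Disjoint.mono Set.inter_subset_left Set.inter_subset_left ?_
          rcases lt_or_gt_of_ne hij with h | h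
          exacts [hdisj i j h, (hdisj j i h).symm]
        · exact fun k _ => (hAm k).inter (hBm k)
    _ ≤ 2 * P.real {ω | c < ‖∑ i ∈ Finset.Ico a (a + m), X i ω‖} :=
        mul_le_mul_of_nonneg_left (measureReal_mono hsub) zero_le_two

end Ottaviani

/-! ### The deterministic estimate -/

theorem embed_eq_sum {d : ℕ} (x : EuclideanSpace ℝ (Fin d)) :
    embed d x = ∑ i : Fin d, x i • (lp.single 2 (i : ℕ) (1 : ℝ) : L2Seq) := by
  refine Finset.sum_congr rfl fun i _ => ?_
  rw [← lp.single_smul, smul_eq_mul, mul_one]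

theorem embed_sub {d : ℕ} (x y : EuclideanSpace ℝ (Fin d)) :
    embed d (x - y) = embed d x - embed d y := by
  simp [embed_eq_sum, sub_smul]

theorem norm_embed {d : ℕ} (x : EuclideanSpace ℝ (Fin d)) : ‖embed d x‖ = ‖x‖ := by
  have he : Orthonormal ℝ fun l : Fin d => (lp.single 2 (l : ℕ) (1 : ℝ) : L2Seq) :=
    orthonormal_single.comp _ Fin.val_injective
  refine (sq_eq_sq₀ (norm_nonneg _) (norm_nonneg _)).1 ?_
  rw [embed_eq_sum, ← real_inner_self_eq_norm_sq, he.inner_sum, EuclideanSpace.real_norm_sq_eq]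
  simp [sq]

/-- The point of the rescaled walk at time `k`. -/
def walkPoint {d : ℕ} (n : ℕ) (x : ℕ → EuclideanSpace ℝ (Fin d)) (k : ℕ) : L2Seq :=
  embed d ((√(n : ℝ))⁻¹ • ∑ i ∈ Finset.range k, x i)

theorem norm_walkPoint_sub {d : ℕ} (n : ℕ) (x : ℕ → EuclideanSpace ℝ (Fin d)) {j k : ℕ}
    (hjk : j ≤ k) :
    ‖walkPoint n x k - walkPoint n x j‖ = (√(n : ℝ))⁻¹ * ‖∑ i ∈ Finset.Ico j k, x i‖ := by
  rw [walkPoint, walkPoint, ← embed_sub, norm_embed, ← smul_sub, norm_smul,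
    ← Finset.sum_Ico_eq_sub _ hjk, Real.norm_of_nonneg (by positivity)]

theorem exists_between_of_le {q : ℕ → ℕ} (h0 : q 0 = 0) {N k : ℕ} (hN : 0 < N) (hk : k ≤ q N) :
    ∃ i < N, q i ≤ k ∧ k ≤ q (i + 1) := by
  induction N, hN using Nat.le_induction with
  | base => exact ⟨0, Nat.one_pos, by omega, hk⟩
  | succ N hN ih =>
    rcases le_or_gt k (q N) with h | h
    · obtain ⟨i, hi, h'⟩ := ih h
      exact ⟨i, by omega, h'⟩
    · exact ⟨N, by omega, h.le, hk⟩

/-- Both floors err in the same direction by less than one, so their difference errs by at most one.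
-/
theorem abs_grid_sub_le {n N i j : ℕ} (hn : 0 < n) (hN : 0 < N) (hij : i ≤ j) :
    |((j * n / N - i * n / N : ℕ) : ℝ) / n - ((j : ℝ) - i) / N| ≤ 1 / n := by
  have hn' : (0 : ℝ) < n := by exact_mod_cast hn
  have hN' : (0 : ℝ) < N := by exact_mod_cast hN
  have hle : i * n / N ≤ j * n / N := Nat.div_le_div_right (Nat.mul_le_mul_right n hij)
  have hfl : ∀ k : ℕ, ((k * n / N : ℕ) : ℝ) ≤ k * n / N ∧
      (k * n / N : ℝ) < ((k * n / N : ℕ) : ℝ) + 1 := by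
    intro k
    refine ⟨by simpa using (Nat.cast_div_le (α := ℝ) (m := k * n) (n := N)), ?_⟩
    rw [div_lt_iff₀ hN']
    exact_mod_cast Nat.lt_mul_of_div_lt (Nat.lt_succ_self (k * n / N)) hN
  obtain ⟨i1, i2⟩ := hfl i
  obtain ⟨j1, j2⟩ := hfl j
  rw [Nat.cast_sub hle]
  have heq : (((j * n / N : ℕ) : ℝ) - ((i * n / N : ℕ) : ℝ)) / n - ((j : ℝ) - i) / N =
      ((((j * n / N : ℕ) : ℝ) - j * n / N) - (((i * n / N : ℕ) : ℝ) - i * n / N)) / n := by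
    field_simp
    ring
  rw [heq, abs_div, abs_of_pos hn']
  gcongr
  rw [abs_le]
  constructor <;> linarith

/-- The three terms are the oscillation of the walk within a block, the mismatch of the grid points
after dilation, and the oscillation of the spiral within a block. -/
theorem hdist_walkSet_spiral_le {d n N : ℕ} (hn : 0 < n) (hN : 0 < N)
    {x : ℕ → EuclideanSpace ℝ (Fin d)} {δ r : ℝ} (hr : 0 ≤ r)
    (hgrid : ∀ i j, i ≤ j → j ≤ N →
      |‖∑ l ∈ Finset.Ico (i * n / N) (j * n / N), x l‖ ^ 2 - (j * n / N - i * n / N : ℕ)| ≤ δ * n)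
    (hosc : ∀ i < N, ∀ k, i * n / N ≤ k → k ≤ (i + 1) * n / N →
      ‖∑ l ∈ Finset.Ico (i * n / N) k, x l‖ ≤ r * √n) :
    Shape.hdist (Shape.mk (walkSet n x)) (Shape.mk spiral) ≤
      r + √((4 * (N : ℝ) ^ 2 + 1) * (δ + 1 / n)) + √(1 / N) := by
  have hn' : (0 : ℝ) < n := by exact_mod_cast hn
  have hN' : (0 : ℝ) < N := by exact_mod_cast hN
  have hmono : ∀ i j, i ≤ j → i * n / N ≤ j * n / N := fun i j hij =>
    Nat.div_le_div_right (Nat.mul_le_mul_right n hij)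
  have hqN : N * n / N = n := Nat.mul_div_cancel_left n hN
  set y : ℕ → L2Seq := fun i => walkPoint n x (i * n / N) with hy
  have hy0 : y 0 = 0 := by
    simp [hy, walkPoint, embed_eq_sum]
  have hyd : ∀ i j, i ≤ j → j ≤ N → |‖y j - y i‖ ^ 2 - ((j : ℝ) - i) / N| ≤ δ + 1 / n := by
    intro i j hij hj
    have h1 : ‖y j - y i‖ ^ 2 = ‖∑ l ∈ Finset.Ico (i * n / N) (j * n / N), x l‖ ^ 2 / n := by
      rw [hy, norm_walkPoint_sub n x (hmono i j hij), mul_pow, inv_pow, Real.sq_sqrt hn'.le]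
      field_simp
    have h2 := abs_grid_sub_le hn hN hij
    have h3 : |‖y j - y i‖ ^ 2 - ((j * n / N - i * n / N : ℕ) : ℝ) / n| ≤ δ := by
      rw [h1, ← sub_div, abs_div, abs_of_pos hn', div_le_iff₀ hn']
      exact hgrid i j hij hj
    exact (abs_sub_le _ _ _).trans (add_le_add h3 h2)
  have hδ : ∀ i ≤ N, ∀ j ≤ N, |‖y i - y j‖ ^ 2 - |(i : ℝ) - j| / N| ≤ δ + 1 / n := by
    intro i hi j hj
    rcases le_total i j with h | h
    · have h' : (i : ℝ) ≤ j := by exact_mod_cast h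
      rw [norm_sub_rev, abs_sub_comm (i : ℝ), abs_of_nonneg (sub_nonneg.2 h')]
      exact hyd i j h hj
    · have h' : (j : ℝ) ≤ i := by exact_mod_cast h
      rw [abs_of_nonneg (sub_nonneg.2 h')]
      exact hyd j i h hi
  obtain ⟨Φ, Ψ, hΦΨ⟩ := exists_isometries_dist_grid_le hN hy0 hδ
  set ρ := √((4 * (N : ℝ) ^ 2 + 1) * (δ + 1 / n))
  have hρ : ∀ i ≤ N, dist (Φ (y i)) (Ψ (spiralPoint (i / N))) ≤ ρ := fun i hi => by
    rw [dist_eq_norm]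
    exact Real.le_sqrt_of_sq_le (hΦΨ i hi)
  have hρ0 : 0 ≤ ρ := Real.sqrt_nonneg _
  have hN0 : 0 ≤ √(1 / (N : ℝ)) := Real.sqrt_nonneg _
  refine (Shape.hdist_le (Shape.mk_map (walkSet n x) Φ Φ.isometry)
    (Shape.mk_map spiral Ψ Ψ.isometry)).trans ?_
  refine dist_le_of_forall_exists_dist_le (by positivity) ?_ ?_
  · rintro _ ⟨_, ⟨k, hk, rfl⟩, rfl⟩
    obtain ⟨i, hi, hik, hki⟩ :=
      exists_between_of_le (q := fun i => i * n / N) (by simp) hN (hqN.symm ▸ hk : k ≤ N * n / N)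
    refine ⟨Ψ (spiralPoint (i / N)), ⟨_, ⟨_, div_mem_Icc hN hi.le, rfl⟩, rfl⟩, ?_⟩
    refine (dist_triangle _ (Φ (y i)) _).trans ?_
    have h1 : dist (Φ (walkPoint n x k)) (Φ (y i)) ≤ r := by
      rw [Φ.dist_map, dist_eq_norm, hy, norm_walkPoint_sub n x hik]
      have := hosc i hi k hik hki
      rw [inv_mul_le_iff₀ (Real.sqrt_pos.2 hn'), mul_comm (√(n : ℝ))]
      exact this
    have h2 := hρ i hi.le
    change dist (Φ (walkPoint n x k)) (Φ (y i)) + _ ≤ _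
    linarith
  · rintro _ ⟨_, ⟨t, ht, rfl⟩, rfl⟩
    have htN : 0 ≤ t * N := mul_nonneg ht.1 hN'.le
    have hi : ⌊t * N⌋₊ ≤ N := by
      refine Nat.floor_le_of_le ?_
      nlinarith [ht.2]
    refine ⟨Φ (y ⌊t * N⌋₊), ⟨_, ⟨⌊t * N⌋₊ * n / N, ?_, rfl⟩, rfl⟩, ?_⟩
    · exact (hmono _ _ hi).trans hqN.le
    refine (dist_triangle _ (Ψ (spiralPoint (⌊t * N⌋₊ / N))) _).trans ?_
    have h1 : dist (Ψ (spiralPoint t)) (Ψ (spiralPoint (⌊t * N⌋₊ / N))) ≤ √(1 / N) := by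
      rw [Ψ.dist_map, dist_eq_norm]
      refine Real.le_sqrt_of_sq_le ?_
      rw [norm_spiralPoint_sub_sq (div_mem_Icc hN hi) ht]
      have e : t - ⌊t * N⌋₊ / N = (t * N - ⌊t * N⌋₊) / N := by field_simp
      rw [e, abs_div, abs_of_pos hN']
      gcongr
      rw [abs_le]
      constructor <;> linarith [Nat.floor_le htN, Nat.lt_floor_add_one (t * N)]
    have h2 := hρ _ hi
    rw [dist_comm] at h2
    linarith

/-! ### Convergence in probability -/

theorem integral_norm_sq_sub_truncSq_le {Ω : Type*} [MeasurableSpace Ω] {P : Measure Ω} {d : ℕ}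
    {Z : Ω → EuclideanSpace ℝ (Fin d)} (hZ : Measurable Z) {A η : ℝ} (hη : 0 ≤ η)
    (h : ∫⁻ ω in {ω | A < ‖Z ω‖ ^ 2}, ENNReal.ofReal (‖Z ω‖ ^ 2) ∂P ≤ ENNReal.ofReal η) :
    ∫ ω, (‖Z ω‖ ^ 2 - truncSq A (Z ω)) ∂P ≤ η := by
  have hm : Measurable fun ω => ‖Z ω‖ ^ 2 - truncSq A (Z ω) :=
    (hZ.norm.pow_const 2).sub ((measurable_truncSq A).comp hZ)
  have hset : MeasurableSet {ω | A < ‖Z ω‖ ^ 2} :=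
    measurableSet_lt measurable_const (hZ.norm.pow_const 2)
  rw [integral_eq_lintegral_of_nonneg_ae
    (Eventually.of_forall fun ω => sub_nonneg.2 (truncSq_le A _)) hm.aestronglyMeasurable]
  refine ENNReal.toReal_le_of_le_ofReal hη (le_trans (le_of_eq ?_) h)
  rw [← lintegral_indicator hset]
  refine lintegral_congr fun ω => ?_
  rcases lt_or_ge A (‖Z ω‖ ^ 2) with hω | hω
  · rw [Set.indicator_of_mem (by exact hω), truncSq, if_neg (not_le.2 hω), sub_zero]
  · rw [Set.indicator_of_notMem (by simpa using hω), truncSq, if_pos hω, sub_self,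
      ENNReal.ofReal_zero]

section Convergence

variable {Ω : ℕ → Type*} [∀ d, MeasurableSpace (Ω d)] {P : ∀ d, Measure (Ω d)}
  [∀ d, IsProbabilityMeasure (P d)] {X : ∀ d, ℕ → Ω d → EuclideanSpace ℝ (Fin d)} {n : ℕ → ℕ}

/-- The truncation level is fixed first, uniformly in `d`; then `v → 0` and `n → ∞` remove the other
two terms. -/
theorem eventually_measureReal_norm_sq_sub_card_le {v : ℕ → ℝ}
    (hX : ∀ d, 1 ≤ d → IsIncrements (P d) (X d) (v d)) (hv : Tendsto v atTop (𝓝 0))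
    (hn : Tendsto n atTop atTop)
    (htail : ∀ η : ℝ, 0 < η → ∃ A : ℝ, 0 ≤ A ∧ ∀ d, 1 ≤ d → ∀ i,
      ∫ ω, (‖X d i ω‖ ^ 2 - truncSq A (X d i ω)) ∂(P d) ≤ η)
    {ε η : ℝ} (hε : 0 < ε) (hη : 0 < η) :
    ∀ᶠ d in atTop, ∀ s : Finset ℕ, s.card ≤ n d →
      (P d).real {ω | ε * n d ≤ |‖∑ i ∈ s, X d i ω‖ ^ 2 - s.card|} ≤ η := by
  set e := ε / 3 with he
  have he0 : 0 < e := by positivity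
  obtain ⟨A, hA, hAt⟩ := htail (η * e / 6) (by positivity)
  have h1 : Tendsto (fun d => 2 * v d / e ^ 2) atTop (𝓝 0) := by
    simpa using (hv.const_mul 2).div_const (e ^ 2)
  have h2 : Tendsto (fun d => A / (n d * e ^ 2)) atTop (𝓝 0) :=
    ((tendsto_natCast_atTop_atTop.comp hn).atTop_mul_const (by positivity)).const_div_atTop A
  filter_upwards [h1.eventually_lt_const (by positivity : 0 < η / 3),
    h2.eventually_lt_const (by positivity : 0 < η / 3), eventually_ge_atTop 1,
    hn.eventually_ge_atTop 1] with d hd1 hd2 hd hnd s hs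
  have h := (hX d hd).measureReal_abs_norm_sq_sub_card_le hA (hAt d hd) hnd hs he0
  rw [show 3 * e = ε by rw [he]; ring] at h
  refine h.trans ?_
  have : 2 * (η * e / 6) / e = η / 3 := by field_simp; norm_num
  linarith

theorem measureReal_lt_norm_le {d : ℕ} {c ε η : ℝ} (hc : 0 ≤ c) {s : Finset ℕ}
    (hs : (s.card : ℝ) + ε * n d ≤ c ^ 2)
    (h : (P d).real {ω | ε * n d ≤ |‖∑ i ∈ s, X d i ω‖ ^ 2 - s.card|} ≤ η) :
    (P d).real {ω | c < ‖∑ i ∈ s, X d i ω‖} ≤ η := by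
  refine (measureReal_mono fun ω hω => ?_).trans h
  rw [Set.mem_ofPred_eq] at hω ⊢
  have : c ^ 2 ≤ ‖∑ i ∈ s, X d i ω‖ ^ 2 := by gcongr
  exact le_trans (by linarith) (le_abs_self _)

theorem tendsto_measure_hdist_walkSet (hmeas : ∀ d, 1 ≤ d → ∀ i, Measurable (X d i))
    (hind : ∀ d, 1 ≤ d → iIndepFun (X d) (P d)) (hn : Tendsto n atTop atTop)
    (hlln : ∀ ε : ℝ, 0 < ε → ∀ η : ℝ, 0 < η → ∀ᶠ d in atTop, ∀ s : Finset ℕ, s.card ≤ n d →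
      (P d).real {ω | ε * n d ≤ |‖∑ i ∈ s, X d i ω‖ ^ 2 - s.card|} ≤ η)
    {ε : ℝ} (hε : 0 < ε) :
    Tendsto (fun d => (P d).real {ω | ε < Shape.hdist
      (Shape.mk (walkSet (n d) fun i => X d i ω)) (Shape.mk spiral)}) atTop (𝓝 0) := by
  -- A block then has length at most `(1/N + 1/n) * n ≤ ε²/128 * n`; allowing as much again for
  -- fluctuation gives `c ^ 2 = ε²/64 * n`, and Ottaviani's `2 * c` is `ε/4 * √n`. Also `√(1/N) ≤
  -- ε/16`.
  obtain ⟨N, hNε⟩ := exists_nat_gt (256 / ε ^ 2)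
  have hN' : (0 : ℝ) < N := lt_trans (by positivity) hNε
  have hN : 0 < N := by exact_mod_cast hN'
  have hNinv : 1 / (N : ℝ) ≤ ε ^ 2 / 256 := by
    rw [div_lt_iff₀ (by positivity)] at hNε
    rw [div_le_div_iff₀ hN' (by norm_num)]
    linarith
  -- Chosen so that `(4N² + 1) * 2δ = (ε/4)²`.
  set δ : ℝ := ε ^ 2 / (32 * (4 * (N : ℝ) ^ 2 + 1)) with hδ
  have hδ0 : 0 < δ := by positivity
  rw [Metric.tendsto_nhds]
  intro η hη
  -- Union bound: `(N + 1)²` grid pairs, and `N` blocks with Ottaviani's factor 2. The cap `1 / 2`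
  -- on `η'` below serves Ottaviani's hypothesis.
  set C : ℝ := (N + 1) * (N + 1) + N * 2 with hC
  have hC0 : 0 < C := by positivity
  set η' := min (1 / 2) (η / (2 * C)) with hη'
  have hη'0 : 0 < η' := by positivity
  have hninv : ∀ a : ℝ, 0 < a → ∀ᶠ d in atTop, 1 / (n d : ℝ) < a := fun a ha =>
    ((tendsto_natCast_atTop_atTop.comp hn).const_div_atTop 1).eventually_lt_const ha
  filter_upwards [hlln δ hδ0 η' hη'0, hlln (ε ^ 2 / 128) (by positivity) η' hη'0,
    eventually_ge_atTop 1, hn.eventually_ge_atTop 1, hninv δ hδ0,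
    hninv (ε ^ 2 / 256) (by positivity)] with d hd1 hd2 hd hnd hnδ hnε
  have hn' : (0 : ℝ) < n d := by exact_mod_cast hnd
  set q : ℕ → ℕ := fun i => i * n d / N with hq
  have hqmono : ∀ i j, i ≤ j → q i ≤ q j := fun i j hij =>
    Nat.div_le_div_right (Nat.mul_le_mul_right _ hij)
  have hqN : q N = n d := Nat.mul_div_cancel_left _ hN
  have hqle : ∀ i ≤ N, q i ≤ n d := fun i hi => (hqmono i N hi).trans hqN.le
  set c : ℝ := ε / 8 * √(n d) with hc
  have hc0 : 0 ≤ c := by positivity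
  have hc2 : c ^ 2 = ε ^ 2 / 64 * n d := by
    rw [hc, mul_pow, Real.sq_sqrt hn'.le]
    ring
  set B₁ : ℕ → ℕ → Set (Ω d) := fun i j =>
    {ω | δ * n d ≤ |‖∑ l ∈ Finset.Ico (q i) (q j), X d l ω‖ ^ 2 - (Finset.Ico (q i) (q j)).card|}
  set B₂ : ℕ → Set (Ω d) := fun i =>
    {ω | ∃ k ≤ q (i + 1) - q i, 2 * c < ‖∑ l ∈ Finset.Ico (q i) (q i + k), X d l ω‖}
  have hB₁ : ∀ i ≤ N, ∀ j ≤ N, (P d).real (B₁ i j) ≤ η' := by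
    intro i _ j hj
    refine hd1 _ ?_
    rw [Nat.card_Ico]
    exact (Nat.sub_le _ _).trans (hqle j hj)
  have hlen : ∀ i, ((q (i + 1) - q i : ℕ) : ℝ) ≤ ε ^ 2 / 128 * n d := by
    intro i
    have h := (abs_le.1 (abs_grid_sub_le hnd hN (Nat.le_succ i))).2
    have h1 : ((q (i + 1) - q i : ℕ) : ℝ) / n d ≤ ε ^ 2 / 128 := by
      have : ((i + 1 : ℕ) - (i : ℝ)) / N = 1 / N := by
        push_cast
        ring
      simp only [Nat.succ_eq_add_one] at h
      rw [this] at h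
      linarith
    exact (div_le_iff₀ hn').1 h1
  have hB₂ : ∀ i < N, (P d).real (B₂ i) ≤ 2 * η' := by
    intro i hi
    have hsub : ∀ a b, q i ≤ a → b ≤ q (i + 1) →
        (P d).real {ω | c < ‖∑ l ∈ Finset.Ico a b, X d l ω‖} ≤ η' := by
      intro a b ha hb
      have hcard : (Finset.Ico a b).card ≤ q (i + 1) - q i := by
        rw [Nat.card_Ico]
        omega
      have hcard' : ((Finset.Ico a b).card : ℝ) ≤ ((q (i + 1) - q i : ℕ) : ℝ) := by
        exact_mod_cast hcard
      refine measureReal_lt_norm_le hc0 (ε := ε ^ 2 / 128) ?_ (hd2 _ ?_)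
      · linarith [hlen i]
      · exact hcard.trans ((Nat.sub_le _ _).trans (hqle _ hi))
    have hqi := hqmono i (i + 1) (Nat.le_succ i)
    refine (ottaviani (hmeas d hd) (hind d hd) (q i) (q (i + 1) - q i) fun k _ => ?_).trans ?_
    · exact (hsub _ _ (Nat.le_add_right _ _) (by omega)).trans (min_le_left _ _)
    · exact mul_le_mul_of_nonneg_left (hsub _ _ le_rfl (by omega)) zero_le_two
  have hsub : {ω | ε < Shape.hdist (Shape.mk (walkSet (n d) fun i => X d i ω))
      (Shape.mk spiral)} ⊆ (⋃ i ∈ Finset.range (N + 1), ⋃ j ∈ Finset.range (N + 1), B₁ i j) ∪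
        ⋃ i ∈ Finset.range N, B₂ i := by
    intro ω hω
    rw [Set.mem_ofPred_eq] at hω
    by_contra hcon
    simp only [Set.mem_union, Set.mem_iUnion, not_or, not_exists, Finset.mem_range] at hcon
    obtain ⟨hc1, hcc2⟩ := hcon
    refine absurd hω (not_lt.2 ((hdist_walkSet_spiral_le hnd hN (r := ε / 4) (δ := δ)
      (by positivity) ?_ ?_).trans ?_))
    · intro i j hij hj
      have := hc1 i (by omega) j (by omega)
      simp only [B₁, Set.mem_ofPred_eq, not_le, Nat.card_Ico] at this
      exact this.le
    · intro i hi k hik hki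
      have := hcc2 i hi
      simp only [B₂, Set.mem_ofPred_eq, not_exists, not_and, not_lt] at this
      have h := this (k - q i) (Nat.sub_le_sub_right hki _)
      rw [Nat.add_sub_cancel' hik] at h
      refine h.trans (le_of_eq ?_)
      rw [hc]
      ring
    · have h1 : √((4 * (N : ℝ) ^ 2 + 1) * (δ + 1 / n d)) ≤ ε / 4 := by
        refine Real.sqrt_le_iff.2 ⟨by positivity, ?_⟩
        calc (4 * (N : ℝ) ^ 2 + 1) * (δ + 1 / n d) ≤ (4 * (N : ℝ) ^ 2 + 1) * (δ + δ) := by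
              gcongr
          _ = (ε / 4) ^ 2 := by
              rw [hδ]
              field_simp
              norm_num
      have h2 : √(1 / (N : ℝ)) ≤ ε / 16 := by
        refine Real.sqrt_le_iff.2 ⟨by positivity, hNinv.trans (le_of_eq ?_)⟩
        ring
      linarith
  have hbound : (P d).real {ω | ε < Shape.hdist (Shape.mk (walkSet (n d) fun i => X d i ω))
      (Shape.mk spiral)} ≤ C * η' := by
    refine (measureReal_mono hsub (measure_ne_top _ _)).trans
      ((measureReal_union_le _ _).trans ?_)
    have h1 : (P d).real (⋃ i ∈ Finset.range (N + 1), ⋃ j ∈ Finset.range (N + 1), B₁ i j) ≤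
        (N + 1) * ((N + 1) * η') := by
      refine (measureReal_biUnion_finset_le _ _).trans
        ((Finset.sum_le_card_nsmul _ _ ((N + 1) * η') fun i hi => ?_).trans (le_of_eq ?_))
      · refine (measureReal_biUnion_finset_le _ _).trans
          ((Finset.sum_le_card_nsmul _ _ η' fun j hj => ?_).trans (le_of_eq ?_))
        · exact hB₁ i (Nat.lt_succ_iff.1 (Finset.mem_range.1 hi)) j
            (Nat.lt_succ_iff.1 (Finset.mem_range.1 hj))
        · simp
      · simp
    have h2 : (P d).real (⋃ i ∈ Finset.range N, B₂ i) ≤ N * (2 * η') := by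
      refine (measureReal_biUnion_finset_le _ _).trans
        ((Finset.sum_le_card_nsmul _ _ (2 * η') fun i hi => ?_).trans (le_of_eq ?_))
      · exact hB₂ i (Finset.mem_range.1 hi)
      · simp
    refine (add_le_add h1 h2).trans (le_of_eq ?_)
    rw [hC]
    ring
  rw [Real.dist_eq, sub_zero, abs_of_nonneg measureReal_nonneg]
  refine hbound.trans_lt ?_
  calc C * η' ≤ C * (η / (2 * C)) := mul_le_mul_of_nonneg_left (min_le_right _ _) hC0.le
    _ = η / 2 := by field_simp
    _ < η := by linarith

end Convergence

end WienerSpiral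

end

/-! ### The main theorem, assembled from the law of large numbers and the Lipschitz property. -/

theorem mainTheorem6
    {Ω : ℕ → Type*} [∀ d, MeasurableSpace (Ω d)]
    (P : ∀ d, Measure (Ω d)) [∀ d, IsProbabilityMeasure (P d)]
    (X : ∀ d, ℕ → Ω d → EuclideanSpace ℝ (Fin d))
    (n : ℕ → ℕ) (hn_pos : ∀ d, 1 ≤ d → 1 ≤ n d) (hn : Tendsto n atTop atTop)
    -- the increments are independent and identically distributed random vectors
    (hX_meas : ∀ d, 1 ≤ d → ∀ i, Measurable (X d i))
    (hX_indep : ∀ d, 1 ≤ d → iIndepFun (X d) (P d))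
    (hX_ident : ∀ d, 1 ≤ d → ∀ i, IdentDistrib (X d i) (X d 0) (P d) (P d))
    -- (a) centered and normalized
    (hX_mean : ∀ d, 1 ≤ d → ∫ ω, X d 0 ω ∂(P d) = 0)
    (hX_norm : ∀ d, 1 ≤ d → ∫ ω, ‖X d 0 ω‖ ^ 2 ∂(P d) = 1)
    -- (b) uncorrelated components
    (hX_uncor : ∀ d, 1 ≤ d → ∀ j k : Fin d, j ≠ k → ∫ ω, X d 0 ω j * X d 0 ω k ∂(P d) = 0)
    -- (c) uniform integrability of the squared norms
    (hX_ui : Tendsto (fun A : ℝ => ⨆ d : ℕ, ⨆ _ : 1 ≤ d,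
        ∫⁻ ω in {ω | A < ‖X d 0 ω‖ ^ 2}, ENNReal.ofReal (‖X d 0 ω‖ ^ 2) ∂(P d)) atTop (𝓝 0))
    -- (d) negligibility of the components
    (hX_negl : Tendsto (fun d : ℕ => ⨆ k : Fin d, ∫ ω, (X d 0 ω k) ^ 2 ∂(P d)) atTop (𝓝 0)) :
    -- convergence in probability of the convex hulls
    (∀ ε : ℝ, 0 < ε → Tendsto (fun d : ℕ => P d {ω | ε <
        WienerSpiral.Shape.hdist
          (WienerSpiral.Shape.mk (WienerSpiral.walkHull (n d) (fun i => X d i ω)))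
          (WienerSpiral.Shape.mk (WienerSpiral.cch WienerSpiral.spiral))}) atTop (𝓝 0)) ∧
    -- the closed convex hull map is well defined and 1-Lipschitz on isometry classes
    (∃ CCH : WienerSpiral.Shape → WienerSpiral.Shape,
      (∀ K, CCH (WienerSpiral.Shape.mk K) = WienerSpiral.Shape.mk (WienerSpiral.cch K)) ∧
      ∀ x y, WienerSpiral.Shape.hdist (CCH x) (CCH y) ≤ WienerSpiral.Shape.hdist x y) := by

  have hlln : ∀ ε : ℝ, 0 < ε → ∀ η : ℝ, 0 < η → ∀ᶠ d in atTop, ∀ s : Finset ℕ, s.card ≤ n d →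
      (P d).real {ω | ε * n d ≤ |‖∑ i ∈ s, X d i ω‖ ^ 2 - s.card|} ≤ η := by
    intro ε hε η hη
    refine WienerSpiral.eventually_measureReal_norm_sq_sub_card_le
      (v := fun d => ⨆ k : Fin d, ∫ ω, (X d 0 ω k) ^ 2 ∂(P d)) (fun d hd => ?_) hX_negl hn ?_ hε hη
    · refine ⟨hX_meas d hd, hX_indep d hd, fun i => ?_, fun i => ?_, fun i j k hjk => ?_,
        fun i k => ?_, Real.iSup_nonneg fun k => integral_nonneg fun ω => sq_nonneg _⟩
      · rw [(hX_ident d hd i).integral_eq, hX_mean d hd]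
      · rw [← hX_norm d hd]
        exact ((hX_ident d hd i).comp (u := fun z => ‖z‖ ^ 2) (by fun_prop)).integral_eq
      · rw [← hX_uncor d hd j k hjk]
        exact ((hX_ident d hd i).comp (u := fun z : EuclideanSpace ℝ (Fin d) => z j * z k)
          (by fun_prop)).integral_eq
      · have h : ∫ ω, X d i ω k ^ 2 ∂(P d) = ∫ ω, X d 0 ω k ^ 2 ∂(P d) :=
          ((hX_ident d hd i).comp (u := fun z : EuclideanSpace ℝ (Fin d) => z k ^ 2)
            (by fun_prop)).integral_eq
        rw [h]
        exact le_ciSup (f := fun k : Fin d => ∫ ω, X d 0 ω k ^ 2 ∂(P d))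
          (Set.finite_range _).bddAbove k
    · intro η hη
      obtain ⟨A, hA, hA0⟩ := ((hX_ui.eventually_le_const
        (ENNReal.ofReal_pos.2 hη)).and (eventually_ge_atTop 0)).exists
      refine ⟨A, hA0, fun d hd i => ?_⟩
      have h : ∫ ω, (‖X d i ω‖ ^ 2 - WienerSpiral.truncSq A (X d i ω)) ∂(P d) =
          ∫ ω, (‖X d 0 ω‖ ^ 2 - WienerSpiral.truncSq A (X d 0 ω)) ∂(P d) :=
        ((hX_ident d hd i).comp
          (u := fun z : EuclideanSpace ℝ (Fin d) => ‖z‖ ^ 2 - WienerSpiral.truncSq A z)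
          ((by fun_prop : Measurable fun z : EuclideanSpace ℝ (Fin d) => ‖z‖ ^ 2).sub
            (WienerSpiral.measurable_truncSq A))).integral_eq
      rw [h]
      refine WienerSpiral.integral_norm_sq_sub_truncSq_le (hX_meas d hd 0) hη.le (le_trans ?_ hA)
      exact le_iSup₂ (f := fun (d : ℕ) (_ : 1 ≤ d) => ∫⁻ ω in {ω | A < ‖X d 0 ω‖ ^ 2},
        ENNReal.ofReal (‖X d 0 ω‖ ^ 2) ∂(P d)) d hd
  refine ⟨fun ε hε => ?_, WienerSpiral.Shape.cch, WienerSpiral.Shape.cch_mk,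
    WienerSpiral.Shape.hdist_cch_le⟩
  have h := WienerSpiral.tendsto_measure_hdist_walkSet hX_meas hX_indep hn hlln hε
  rw [← ENNReal.tendsto_toReal_iff (fun d => measure_ne_top _ _) ENNReal.zero_ne_top]
  refine squeeze_zero (fun d => ENNReal.toReal_nonneg) (fun d => ?_) h
  -- The 1-Lipschitz property puts the bad event for the hulls inside that for the walks;
  -- monotonicity needs no measurability of either.
  refine measureReal_mono (fun ω hω => ?_) (measure_ne_top _ _)
  rw [Set.mem_ofPred_eq] at hω ⊢
  refine hω.trans_le ?_
  rw [← WienerSpiral.cch_walkSet, ← WienerSpiral.Shape.cch_mk, ← WienerSpiral.Shape.cch_mk]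
  exact WienerSpiral.Shape.hdist_cch_le _ _
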